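/- Let $k$ be an algebraically closed field, $G$ a connected affine algebraic group over $k$ (reduced, of finite type), $N$ a closed normal $k$-subgroup scheme of $G$ (not necessarily reduced), and $Q$ a finite-dimensional rational $N$-module, given by $\rho:N\to GL_k(Q)$. Let $V\subseteq Q$ be a $G$-submodule of $Q$ (a subspace with a rational $G$-module structure whose restriction to $N$ is the action induced by $\rho$) with $\operatorname{soc}^N Q\subseteq V$. Suppose that $(Q,V)$ is a strongly $G$-stable pair with structure map $\alpha$, that is, $\alpha:G\to GL_k(Q)$ is a morphism of $k$-schemes such that for all commutative $k$-algebras $S$, $g\in G(S)$, $n\in N(S)$ and $v\in V\otimes S$: $$\alpha(g)\rho(n)=\rho(gng^{-1})\alpha(g),\qquad \alpha(1)=1,\qquad \alpha(gn)=\alpha(g)\rho(n),\qquad \alpha(g)v=gv .$$ Let $J_V\subseteq \operatorname{End}_N(Q)$ be the annihilator of $V$, let $U=1_Q+J_V\subseteq GL_k(Q)$, and let $G^\diamond$ be the $k$-group scheme with underlying scheme $U\times G$ and multiplication $$(x,g)(y,h)=\bigl(x\cdot\alpha(g)y\alpha(g)^{-1}\cdot\alpha(g)\alpha(h)\alpha(gh)^{-1},\;gh\bigr).$$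 It is an extension $1\to U\to G^\diamond\xrightarrow{\pi}G\to1$ with $\pi(x,g)=g$; the map $\iota:N\to G^\diamond$, $\iota(n)=(1,n)$, is a homomorphism with normal image $\iota(N)$, and $\pi$ induces an extension $1\to U\to G^\diamond/\iota(N)\to G/N\to1$. The following statements are equivalent. 1. The action of $N$ on $Q$ extends to a rational $G$-action on $Q$ agreeing with the given action of $G$ on $V$. 2. The exact sequence $1\to U\to G^\diamond\to G\to 1$ of algebraic groups is split by a homomorphism $G\to G^\diamond$ extending $\iota:N\to G^\diamond$. 3. The exact sequence $1\to U\to G^\diamond/\iota(N)\to G/N\to 1$ of algebraic groups is split. -/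

import Mathlib

open CategoryTheory Limits
open scoped TensorProduct

universe u

set_option linter.unusedSectionVars false

namespace KGroups

/-! ### Group functors, affine algebraic groups and closed normal subgroup schemes -/

/-- A `k`-group functor: a functor from commutative `k`-algebras to groups.  Homomorphisms of
`k`-group functors are natural transformations. -/
abbrev KGroup (k : Type u) [Field k] := CommAlgCat.{u} k ⥤ GrpCat.{u}

/-- The underlying set-valued `k`-functor. Morphisms of `k`-functors (for affine schemes: morphisms
of `k`-schemes) are natural transformations between these. -/
abbrev KGroup.points {k : Type u} [Field k] (G : KGroup k) := G ⋙ forget GrpCat.{u}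

/-- The value of a homomorphism of `k`-group functors on an `S`-point. -/
def pt {k : Type u} [Field k] {G H : KGroup k} (φ : G ⟶ H) {S : CommAlgCat.{u} k} (g : G.obj S) :
    H.obj S :=
  φ.app S g

/-- The value on an `S`-point of a morphism of the underlying set-valued functors, which need not
be a homomorphism. -/
def val {k : Type u} [Field k] {G H : KGroup k} (α : G.points ⟶ H.points) {S : CommAlgCat.{u} k}
    (g : G.obj S) : H.obj S :=
  α.app S g

section

variable {k : Type u} [Field k] {G H : KGroup k}

theorem val_map (α : G.points ⟶ H.points) {S T : CommAlgCat.{u} k} (f : S ⟶ T)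
    (g : G.obj S) : H.map f (val α g) = val α (G.map f g) :=
  (NatTrans.naturality_apply α f g).symm

theorem pt_map (φ : G ⟶ H) {S T : CommAlgCat.{u} k} (f : S ⟶ T) (g : G.obj S) :
    H.map f (pt φ g) = pt φ (G.map f g) :=
  (NatTrans.naturality_apply φ f g).symm

theorem pt_mul (φ : G ⟶ H) {S : CommAlgCat.{u} k} (g h : G.obj S) :
    pt φ (g * h) = pt φ g * pt φ h :=
  map_mul (φ.app S).hom g h

theorem pt_one (φ : G ⟶ H) {S : CommAlgCat.{u} k} : pt φ (1 : G.obj S) = 1 :=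
  map_one (φ.app S).hom

theorem pt_inv (φ : G ⟶ H) {S : CommAlgCat.{u} k} (g : G.obj S) : pt φ g⁻¹ = (pt φ g)⁻¹ :=
  map_inv (φ.app S).hom g

end

/-- `G` is a connected affine algebraic group over `k`: the functor of points of an affine
`k`-scheme whose coordinate algebra is of finite type and reduced and has a connected spectrum. -/
def IsConnectedAffineAlgebraicGroup {k : Type u} [Field k] (G : KGroup k) : Prop :=
  ∃ A : CommAlgCat.{u} k, Nonempty (G.points.CorepresentableBy A) ∧
    Algebra.FiniteType k A ∧ IsReduced A ∧ ConnectedSpace (PrimeSpectrum A)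

/-- A normal subgroup functor of a `k`-group functor. -/
structure NormalSubgroupFunctor {k : Type u} [Field k] (G : KGroup k) where
  /-- The subgroup of `S`-points. -/
  carrier (S : CommAlgCat.{u} k) : Subgroup (G.obj S)
  normal (S : CommAlgCat.{u} k) : (carrier S).Normal
  map_mem {S T : CommAlgCat.{u} k} (f : S ⟶ T) {g : G.obj S} (hg : g ∈ carrier S) :
    G.map f g ∈ carrier T

attribute [instance] NormalSubgroupFunctor.normal

namespace NormalSubgroupFunctor

variable {k : Type u} [Field k] {G : KGroup k} (N : NormalSubgroupFunctor G)

/-- `N` is a closed subgroup scheme of the affine group scheme `G`: for a coordinate algebra `A` of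
`G`, the subfunctor `N` is cut out by an ideal `I` of `A` (which need not be radical). -/
def IsClosed : Prop :=
  ∃ (A : CommAlgCat.{u} k) (e : G.points.CorepresentableBy A) (I : Ideal A),
    ∀ (S : CommAlgCat.{u} k) (g : G.obj S),
      g ∈ N.carrier S ↔ ∀ a ∈ I, (show A ⟶ S from e.homEquiv.symm g) a = 0

/-- `N` as a `k`-group functor. -/
def toKGroup : KGroup k where
  obj S := GrpCat.of (N.carrier S)
  map {S T} f := GrpCat.ofHom
    (((G.map f).hom.comp (N.carrier S).subtype).codRestrict (N.carrier T)
      fun n => N.map_mem f n.2)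
  map_id S := by
    ext n
    change G.map (𝟙 S) n.1 = n.1
    simp
  map_comp {S T W} f g := by
    ext n
    change G.map (f ≫ g) n.1 = G.map g (G.map f n.1)
    simp

/-- The inclusion `N ⟶ G`. -/
def incl : N.toKGroup ⟶ G where
  app S := GrpCat.ofHom (N.carrier S).subtype
  naturality _ _ _ := rfl

/-- The conjugate `g n g⁻¹` as a point of `N`. -/
def conj {S : CommAlgCat.{u} k} (g : G.obj S) (n : N.toKGroup.obj S) : N.toKGroup.obj S :=
  (⟨g * pt N.incl n * g⁻¹, (N.normal S).conj_mem _ n.2 g⟩ : N.carrier S)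

end NormalSubgroupFunctor

/-! ### The general linear group functor of a vector space -/

section GeneralLinear

variable {k : Type u} [Field k] (Q : Type u) [AddCommGroup Q] [Module k Q]

/-- The map `S ⊗ Q → T ⊗ Q` induced by a homomorphism `f : S → T` of `k`-algebras. -/
noncomputable def changeMap {S T : CommAlgCat.{u} k} (f : S ⟶ T) : S ⊗[k] Q →ₗ[k] T ⊗[k] Q :=
  TensorProduct.map f.hom.toLinearMap LinearMap.id

@[simp] theorem changeMap_tmul {S T : CommAlgCat.{u} k} (f : S ⟶ T) (s : S) (q : Q) :
    changeMap Q f (s ⊗ₜ[k] q) = f.hom s ⊗ₜ[k] q := rfl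

theorem changeMap_smul {S T : CommAlgCat.{u} k} (f : S ⟶ T) (s : S) (x : S ⊗[k] Q) :
    changeMap Q f (s • x) = f.hom s • changeMap Q f x := by
  induction x with
  | zero => simp
  | add x y hx hy => simp only [smul_add, map_add, hx, hy]
  | tmul a q => simp [TensorProduct.smul_tmul']

/-- The `T`-linear endomorphism of `T ⊗ Q` obtained from an `S`-linear endomorphism `x` of `S ⊗ Q`
by base change along `f : S → T`. -/
noncomputable def endMap {S T : CommAlgCat.{u} k} (f : S ⟶ T)
    (x : Module.End S (S ⊗[k] Q)) : Module.End T (T ⊗[k] Q) :=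
  LinearMap.liftBaseChange T
    (changeMap Q f ∘ₗ x.restrictScalars k ∘ₗ TensorProduct.mk k S Q 1)

variable {Q}

theorem endMap_changeMap {S T : CommAlgCat.{u} k} (f : S ⟶ T)
    (x : Module.End S (S ⊗[k] Q)) (y : S ⊗[k] Q) :
    endMap Q f x (changeMap Q f y) = changeMap Q f (x y) := by
  induction y with
  | zero => simp
  | add y z hy hz => simp only [map_add, hy, hz]
  | tmul s q =>
    have h : s ⊗ₜ[k] q = s • ((1 : S) ⊗ₜ[k] q) := by simp [TensorProduct.smul_tmul']
    rw [changeMap_tmul, endMap, LinearMap.liftBaseChange_tmul, h, map_smul, changeMap_smul]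
    rfl

theorem end_ext {T : CommAlgCat.{u} k} {x y : Module.End T (T ⊗[k] Q)}
    (h : ∀ q : Q, x ((1 : T) ⊗ₜ[k] q) = y ((1 : T) ⊗ₜ[k] q)) : x = y := by
  ext q
  simpa using h q

theorem endMap_one_tmul {S T : CommAlgCat.{u} k} (f : S ⟶ T)
    (x : Module.End S (S ⊗[k] Q)) (q : Q) :
    endMap Q f x ((1 : T) ⊗ₜ[k] q) = changeMap Q f (x ((1 : S) ⊗ₜ[k] q)) := by
  rw [← endMap_changeMap, changeMap_tmul, map_one]

variable (Q)

/-- Base change of endomorphisms is multiplicative. -/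
noncomputable def endMapHom {S T : CommAlgCat.{u} k} (f : S ⟶ T) :
    Module.End S (S ⊗[k] Q) →* Module.End T (T ⊗[k] Q) where
  toFun := endMap Q f
  map_one' := end_ext fun q => by rw [endMap_one_tmul]; simp
  map_mul' x y := end_ext fun q => by
    rw [endMap_one_tmul, Module.End.mul_apply, Module.End.mul_apply, endMap_one_tmul,
      endMap_changeMap]

variable (k) in
/-- The `k`-group functor `GL_k(Q)`, with `S`-points the `S`-linear automorphisms of `S ⊗ Q`. -/
noncomputable def GLf : KGroup k where
  obj S := GrpCat.of (LinearMap.GeneralLinearGroup S (S ⊗[k] Q))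
  map f := GrpCat.ofHom (Units.map (endMapHom Q f))
  map_id S := by
    ext x : 2
    refine Units.ext (end_ext fun q => ?_)
    change endMap Q (𝟙 S) x.1 _ = x.1 _
    rw [endMap_one_tmul]
    generalize x.1 ((1 : S) ⊗ₜ[k] q) = y
    induction y with
    | zero => simp
    | add y z hy hz => rw [map_add, hy, hz]
    | tmul s q => rfl
  map_comp {S T W} f g := by
    ext x : 2
    refine Units.ext (end_ext fun q => ?_)
    change endMap Q (f ≫ g) x.1 _ = endMap Q g (endMap Q f x.1) _
    rw [endMap_one_tmul, endMap_one_tmul, endMap_one_tmul]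
    generalize x.1 ((1 : S) ⊗ₜ[k] q) = y
    induction y with
    | zero => simp
    | add y z hy hz => rw [map_add, hy, hz, map_add, map_add]
    | tmul s q => rfl

variable {Q}

/-- The `S`-linear endomorphism of `S ⊗ Q` underlying an `S`-point of `GL_k(Q)`. -/
def GLf.toEnd {S : CommAlgCat.{u} k} (x : (GLf k Q).obj S) : Module.End S (S ⊗[k] Q) :=
  Units.val (show LinearMap.GeneralLinearGroup S (S ⊗[k] Q) from x)

theorem GLf.ext {S : CommAlgCat.{u} k} {x y : (GLf k Q).obj S} (h : GLf.toEnd x = GLf.toEnd y) :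
    x = y := Units.ext h

@[simp] theorem GLf.toEnd_mul {S : CommAlgCat.{u} k} (x y : (GLf k Q).obj S) :
    GLf.toEnd (x * y) = GLf.toEnd x * GLf.toEnd y := rfl

@[simp] theorem GLf.toEnd_one {S : CommAlgCat.{u} k} :
    GLf.toEnd (1 : (GLf k Q).obj S) = 1 := rfl

theorem GLf.toEnd_map {S T : CommAlgCat.{u} k} (f : S ⟶ T) (x : (GLf k Q).obj S) :
    GLf.toEnd ((GLf k Q).map f x) = endMap Q f (GLf.toEnd x) := rfl

/-- The inclusion `S ⊗ V → S ⊗ Q` for a subspace `V` of `Q`. -/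
noncomputable def inclMap (V : Submodule k Q) (S : CommAlgCat.{u} k) :
    S ⊗[k] V →ₗ[S] S ⊗[k] Q := V.subtype.baseChange S

end GeneralLinear

/-! ### Rational modules, socles and strongly stable pairs -/

section Stable

variable {k : Type u} [Field k] {G : KGroup k} {N : NormalSubgroupFunctor G}
  {Q : Type u} [AddCommGroup Q] [Module k Q]

/-- `W` is a submodule of the rational module `Q` of the group functor `M`: all `m ∈ M(S)` map
`S ⊗ W` into itself, for all `S`. -/
def IsSubmodule {M : KGroup k} (ρ : M ⟶ GLf k Q) (W : Submodule k Q) : Prop :=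
  ∀ (S : CommAlgCat.{u} k) (m : M.obj S), ∀ w ∈ W.baseChange S,
    GLf.toEnd (pt ρ m) w ∈ W.baseChange S

/-- `W` is a simple submodule. -/
def IsSimpleSubmodule {M : KGroup k} (ρ : M ⟶ GLf k Q) (W : Submodule k Q) : Prop :=
  IsSubmodule ρ W ∧ W ≠ ⊥ ∧ ∀ W' ≤ W, IsSubmodule ρ W' → W' = ⊥ ∨ W' = W

/-- The socle of `Q`: the sum of all simple submodules. -/
def socle {M : KGroup k} (ρ : M ⟶ GLf k Q) : Submodule k Q :=
  sSup {W | IsSimpleSubmodule ρ W}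

/-- The rational `G`-module `V` (with action `ρV`) is a `G`-submodule of the rational `N`-module
`Q`: `V` is a subspace of `Q` and the restriction of its `G`-action to `N` is that of `Q`. -/
def IsGSubmodule (ρ : N.toKGroup ⟶ GLf k Q) (V : Submodule k Q) (ρV : G ⟶ GLf k V) : Prop :=
  ∀ (S : CommAlgCat.{u} k) (n : N.toKGroup.obj S) (v : S ⊗[k] V),
    GLf.toEnd (pt ρ n) (inclMap V S v) = inclMap V S (GLf.toEnd (pt ρV (pt N.incl n)) v)

/-- The morphism `α : G → GL_k(Q)` of `k`-schemes is a structure map demonstrating that the pair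
`(Q, V)` is strongly `G`-stable. -/
structure IsStructureMap (ρ : N.toKGroup ⟶ GLf k Q) (V : Submodule k Q) (ρV : G ⟶ GLf k V)
    (α : G.points ⟶ (GLf k Q).points) : Prop where
  intertwine {S : CommAlgCat.{u} k} (g : G.obj S) (n : N.toKGroup.obj S) :
    val α g * pt ρ n = pt ρ (N.conj g n) * val α g
  val_one (S : CommAlgCat.{u} k) : val α (1 : G.obj S) = 1
  val_mul {S : CommAlgCat.{u} k} (g : G.obj S) (n : N.toKGroup.obj S) :
    val α (g * pt N.incl n) = val α g * pt ρ n
  restrict {S : CommAlgCat.{u} k} (g : G.obj S) (v : S ⊗[k] V) :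
    GLf.toEnd (val α g) (inclMap V S v) = inclMap V S (GLf.toEnd (pt ρV g) v)

/-- `J_V`: the annihilator of `V` in the algebra `End_N(Q)` of `N`-endomorphisms of `Q`. -/
def annJ (ρ : N.toKGroup ⟶ GLf k Q) (V : Submodule k Q) : Set (Module.End k Q) :=
  {x | (∀ (S : CommAlgCat.{u} k) (n : N.toKGroup.obj S),
      Commute (x.baseChange S) (GLf.toEnd (pt ρ n))) ∧ ∀ v ∈ V, x v = 0}

/-- The `S`-points of `J_V`: the `S`-span of `J_V` in `End_S(S ⊗ Q)`, that is, the image of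
`S ⊗ J_V`. -/
def annJPoints (ρ : N.toKGroup ⟶ GLf k Q) (V : Submodule k Q) (S : CommAlgCat.{u} k) :
    Submodule S (Module.End S (S ⊗[k] Q)) :=
  Submodule.span S ((fun x : Module.End k Q => x.baseChange S) '' annJ ρ V)


/-! A point of `End_S(S ⊗ Q)` lies in `S ⊗ J_V` exactly when it commutes with `N` over every
`S`-algebra and kills `S ⊗ V`. -/

section Descent

variable {S : CommAlgCat.{u} k} {ι : Type u} (c : Module.Basis ι k S) (i : ι)

/-- The `i`-th coordinate `S ⊗ Q → Q` relative to a basis of `S`. -/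
noncomputable def coordMap : S ⊗[k] Q →ₗ[k] Q :=
  TensorProduct.lift (LinearMap.lsmul k Q ∘ₗ c.coord i)

@[simp] theorem coordMap_tmul (s : S) (q : Q) :
    coordMap c i (s ⊗ₜ[k] q) = c.repr s i • q := rfl

/-- The `i`-th coordinate `(S ⊗ T) ⊗ Q → T ⊗ Q` relative to a basis of `S`. -/
noncomputable def coordMap' (T : CommAlgCat.{u} k) : (S ⊗[k] T) ⊗[k] Q →ₗ[k] T ⊗[k] Q :=
  (coordMap c i (Q := T)).rTensor Q

@[simp] theorem coordMap'_tmul (T : CommAlgCat.{u} k) (s : S) (t : T) (q : Q) :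
    coordMap' c i T ((s ⊗ₜ[k] t) ⊗ₜ[k] q) = (c.repr s i • t) ⊗ₜ[k] q := rfl

/-- The `i`-th coordinate of an endomorphism of `S ⊗ Q`. -/
noncomputable def coordEnd (y : Module.End S (S ⊗[k] Q)) : Module.End k Q :=
  coordMap c i ∘ₗ y.restrictScalars k ∘ₗ TensorProduct.mk k S Q 1

theorem coordEnd_apply (y : Module.End S (S ⊗[k] Q)) (q : Q) :
    coordEnd c i y q = coordMap c i (y ((1 : S) ⊗ₜ[k] q)) := rfl

/-- The inclusion of `S` into `S ⊗ T`. -/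
noncomputable def inclL (S T : CommAlgCat.{u} k) : S ⟶ CommAlgCat.of k (S ⊗[k] T) :=
  CommAlgCat.ofHom Algebra.TensorProduct.includeLeft

/-- The inclusion of `T` into `S ⊗ T`. -/
noncomputable def inclR (S T : CommAlgCat.{u} k) : T ⟶ CommAlgCat.of k (S ⊗[k] T) :=
  CommAlgCat.ofHom Algebra.TensorProduct.includeRight

theorem coordMap'_left {T : CommAlgCat.{u} k} (t : T) (w : S ⊗[k] Q) :
    coordMap' c i T (((1 : S) ⊗ₜ[k] t : S ⊗[k] T) • changeMap Q (inclL S T) w) =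
      t ⊗ₜ[k] coordMap c i w := by
  induction w with
  | zero => simp
  | add x y hx hy => rw [map_add, smul_add, map_add, hx, hy, map_add, TensorProduct.tmul_add]
  | tmul s q =>
    have : ((1 : S) ⊗ₜ[k] t : S ⊗[k] T) • changeMap Q (inclL S T) (s ⊗ₜ[k] q) =
        (s ⊗ₜ[k] t : S ⊗[k] T) ⊗ₜ[k] q := by
      change ((1 : S) ⊗ₜ[k] t : S ⊗[k] T) • ((s ⊗ₜ[k] (1 : T) : S ⊗[k] T) ⊗ₜ[k] q) = _
      rw [TensorProduct.smul_tmul', smul_eq_mul, Algebra.TensorProduct.tmul_mul_tmul, one_mul,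
        mul_one]
    rw [this, coordMap'_tmul, coordMap_tmul, TensorProduct.smul_tmul]

theorem coordMap'_right {T : CommAlgCat.{u} k} (s : S) (z : T ⊗[k] Q) :
    coordMap' c i T ((s ⊗ₜ[k] (1 : T) : S ⊗[k] T) • changeMap Q (inclR S T) z) =
      c.repr s i • z := by
  induction z with
  | zero => simp
  | add x y hx hy => rw [map_add, smul_add, map_add, hx, hy, smul_add]
  | tmul t q =>
    have : (s ⊗ₜ[k] (1 : T) : S ⊗[k] T) • changeMap Q (inclR S T) (t ⊗ₜ[k] q) =
        (s ⊗ₜ[k] t : S ⊗[k] T) ⊗ₜ[k] q := by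
      change (s ⊗ₜ[k] (1 : T) : S ⊗[k] T) • (((1 : S) ⊗ₜ[k] t : S ⊗[k] T) ⊗ₜ[k] q) = _
      rw [TensorProduct.smul_tmul', smul_eq_mul, Algebra.TensorProduct.tmul_mul_tmul, one_mul,
        mul_one]
    rw [this, coordMap'_tmul, TensorProduct.smul_tmul']

theorem coordMap'_endMap_right {T : CommAlgCat.{u} k} (y : Module.End S (S ⊗[k] Q))
    (z : T ⊗[k] Q) :
    coordMap' c i T (endMap Q (inclL S T) y (changeMap Q (inclR S T) z)) =
      (coordEnd c i y).baseChange T z := by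
  induction z with
  | zero => simp
  | add x y hx hy => rw [map_add, map_add, map_add, hx, hy, map_add]
  | tmul t q =>
    have : changeMap Q (inclR S T) (t ⊗ₜ[k] q) =
        ((1 : S) ⊗ₜ[k] t : S ⊗[k] T) • changeMap Q (inclL S T) ((1 : S) ⊗ₜ[k] q) := by
      change ((1 : S) ⊗ₜ[k] t : S ⊗[k] T) ⊗ₜ[k] q =
        ((1 : S) ⊗ₜ[k] t : S ⊗[k] T) • (((1 : S) ⊗ₜ[k] (1 : T) : S ⊗[k] T) ⊗ₜ[k] q)
      rw [TensorProduct.smul_tmul', smul_eq_mul, Algebra.TensorProduct.tmul_mul_tmul, one_mul,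
        mul_one]
    rw [this]
    erw [map_smul]
    rw [endMap_changeMap]
    erw [coordMap'_left]
    rfl

theorem coordMap'_endMap_left {T : CommAlgCat.{u} k} (r : Module.End T (T ⊗[k] Q))
    (w : S ⊗[k] Q) :
    coordMap' c i T (endMap Q (inclR S T) r (changeMap Q (inclL S T) w)) =
      r ((1 : T) ⊗ₜ[k] coordMap c i w) := by
  induction w with
  | zero => simp
  | add x y hx hy =>
    rw [map_add, map_add, map_add, hx, hy, map_add, TensorProduct.tmul_add, map_add]
  | tmul s q =>
    have : changeMap Q (inclL S T) (s ⊗ₜ[k] q) =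
        (s ⊗ₜ[k] (1 : T) : S ⊗[k] T) • changeMap Q (inclR S T) ((1 : T) ⊗ₜ[k] q) := by
      change (s ⊗ₜ[k] (1 : T) : S ⊗[k] T) ⊗ₜ[k] q =
        (s ⊗ₜ[k] (1 : T) : S ⊗[k] T) • (((1 : S) ⊗ₜ[k] (1 : T) : S ⊗[k] T) ⊗ₜ[k] q)
      rw [TensorProduct.smul_tmul', smul_eq_mul, Algebra.TensorProduct.tmul_mul_tmul, one_mul,
        mul_one]
    rw [this]
    erw [map_smul]
    rw [endMap_changeMap]
    erw [coordMap'_right]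
    rw [coordMap_tmul, TensorProduct.tmul_smul]
    exact ((r.restrictScalars k).map_smul _ _).symm

theorem coordEnd_mem {ρ : N.toKGroup ⟶ GLf k Q} {V : Submodule k Q}
    (y : Module.End S (S ⊗[k] Q))
    (h1 : ∀ (T : CommAlgCat.{u} k) (f : S ⟶ T) (n : N.toKGroup.obj T),
      Commute (endMap Q f y) (GLf.toEnd (pt ρ n)))
    (h2 : ∀ v ∈ V, y ((1 : S) ⊗ₜ[k] v) = 0) : coordEnd c i y ∈ annJ ρ V := by
  refine ⟨fun T n => end_ext fun q => ?_, fun v hv => by rw [coordEnd_apply, h2 v hv, map_zero]⟩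
  have h := h1 _ (inclL S T) (N.toKGroup.map (inclR S T) n)
  rw [← pt_map, GLf.toEnd_map] at h
  have h' := congrArg (coordMap' c i T) (LinearMap.congr_fun h.eq
    (changeMap Q (inclR S T) ((1 : T) ⊗ₜ[k] q)))
  rw [Module.End.mul_apply, Module.End.mul_apply, endMap_changeMap, coordMap'_endMap_right] at h'
  have h3 : changeMap Q (inclR S T) ((1 : T) ⊗ₜ[k] q) =
      changeMap Q (inclL S T) ((1 : S) ⊗ₜ[k] q) := rfl
  rw [h3, endMap_changeMap, coordMap'_endMap_left] at h'
  exact h'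

theorem eq_sum_coordEnd [FiniteDimensional k Q] (y : Module.End S (S ⊗[k] Q)) :
    ∃ F : Finset ι, y = ∑ j ∈ F, c j • (coordEnd c j y).baseChange S := by
  classical
  let b := Module.finBasis k Q
  have key : ∀ z : S ⊗[k] Q, ∃ F : Finset ι, ∀ F', F ⊆ F' →
      z = ∑ j ∈ F', c j ⊗ₜ[k] coordMap c j z := by
    intro z
    induction z with
    | zero => exact ⟨∅, fun F' _ => by simp⟩
    | add x y hx hy =>
      obtain ⟨F1, h1⟩ := hx
      obtain ⟨F2, h2⟩ := hy
      refine ⟨F1 ∪ F2, fun F' h => ?_⟩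
      simp only [map_add, TensorProduct.tmul_add, Finset.sum_add_distrib]
      rw [← h1 F' (Finset.union_subset_left h), ← h2 F' (Finset.union_subset_right h)]
    | tmul s q =>
      refine ⟨(c.repr s).support, fun F' h => ?_⟩
      simp only [coordMap_tmul, ← TensorProduct.smul_tmul, ← TensorProduct.sum_tmul]
      congr 1
      conv_lhs => rw [← c.linearCombination_repr s]
      rw [Finsupp.linearCombination_apply, Finsupp.sum]
      refine Finset.sum_subset h fun j _ hj => ?_
      rw [Finsupp.notMem_support_iff.mp hj, zero_smul]
  choose F hF using fun j => key (y ((1 : S) ⊗ₜ[k] b j))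
  refine ⟨Finset.univ.biUnion F, ?_⟩
  refine (b.baseChange S).ext fun j => ?_
  rw [Module.Basis.baseChange_apply]
  rw [LinearMap.sum_apply]
  refine (hF j _ (Finset.subset_biUnion_of_mem F (Finset.mem_univ j))).trans ?_
  refine Finset.sum_congr rfl fun l _ => ?_
  rw [LinearMap.smul_apply, LinearMap.baseChange_tmul, TensorProduct.smul_tmul', smul_eq_mul,
    mul_one]
  rfl

end Descent

theorem mem_annJPoints_iff [FiniteDimensional k Q] {ρ : N.toKGroup ⟶ GLf k Q}
    {V : Submodule k Q} {S : CommAlgCat.{u} k} (y : Module.End S (S ⊗[k] Q)) :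
    y ∈ annJPoints ρ V S ↔
      (∀ (T : CommAlgCat.{u} k) (f : S ⟶ T) (n : N.toKGroup.obj T),
        Commute (endMap Q f y) (GLf.toEnd (pt ρ n))) ∧ ∀ v ∈ V, y ((1 : S) ⊗ₜ[k] v) = 0 := by
  constructor
  · intro h
    induction h using Submodule.span_induction with
    | mem y hy =>
      obtain ⟨x, hx, rfl⟩ := hy
      refine ⟨fun T f n => ?_, fun v hv => by simp [hx.2 v hv]⟩
      have : endMap Q f (x.baseChange S) = x.baseChange T :=
        end_ext fun q => by rw [endMap_one_tmul]; simp
      rw [this]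
      exact hx.1 T n
    | zero =>
      refine ⟨fun T f n => ?_, fun v hv => rfl⟩
      have : endMap Q f (0 : Module.End S (S ⊗[k] Q)) = 0 :=
        end_ext fun q => by rw [endMap_one_tmul]; simp
      rw [this]
      exact Commute.zero_left _
    | add y z _ _ hy hz =>
      refine ⟨fun T f n => ?_, fun v hv => by
        rw [LinearMap.add_apply, hy.2 v hv, hz.2 v hv, add_zero]⟩
      have : endMap Q f (y + z) = endMap Q f y + endMap Q f z :=
        end_ext fun q => by simp [endMap_one_tmul]
      rw [this]
      exact (hy.1 T f n).add_left (hz.1 T f n)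
    | smul s y _ hy =>
      refine ⟨fun T f n => ?_, fun v hv => by
        rw [LinearMap.smul_apply, hy.2 v hv, smul_zero]⟩
      have : endMap Q f (s • y) = f.hom s • endMap Q f y :=
        end_ext fun q => by
          rw [endMap_one_tmul, LinearMap.smul_apply, LinearMap.smul_apply, changeMap_smul,
            endMap_one_tmul]
      rw [this]
      exact (hy.1 T f n).smul_left _
  · rintro ⟨h1, h2⟩
    let c := Module.Basis.ofVectorSpace k S
    obtain ⟨F, hF⟩ := eq_sum_coordEnd c y
    rw [hF]
    refine Submodule.sum_mem _ fun j _ => Submodule.smul_mem _ _ (Submodule.subset_span ?_)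
    exact ⟨_, coordEnd_mem c j y h1 h2, rfl⟩

theorem commute_sub_one_iff {T : CommAlgCat.{u} k} (x r : Module.End T (T ⊗[k] Q)) :
    Commute (x - 1) r ↔ Commute x r := by
  constructor <;> intro h <;> refine LinearMap.ext fun z => ?_ <;>
    have h' := LinearMap.congr_fun h.eq z <;>
    simp only [Module.End.mul_apply, LinearMap.sub_apply, Module.End.one_apply, map_sub] at h' ⊢
  · exact sub_left_injective h'
  · rw [h']

/-- The condition for an `S`-point of `GL_k(Q)` to lie in `1 + J_V`. -/
theorem mem_one_add_iff [FiniteDimensional k Q] {ρ : N.toKGroup ⟶ GLf k Q} {V : Submodule k Q}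
    {S : CommAlgCat.{u} k} (x : (GLf k Q).obj S) :
    GLf.toEnd x - 1 ∈ annJPoints ρ V S ↔
      (∀ (T : CommAlgCat.{u} k) (f : S ⟶ T) (n : N.toKGroup.obj T),
        Commute ((GLf k Q).map f x) (pt ρ n)) ∧
      ∀ w : S ⊗[k] V, GLf.toEnd x (inclMap V S w) = inclMap V S w := by
  rw [mem_annJPoints_iff]
  refine and_congr (forall₃_congr fun T f n => ?_) ⟨fun h w => ?_, fun h v hv => ?_⟩
  · have : endMap Q f (GLf.toEnd x - 1) = GLf.toEnd ((GLf k Q).map f x) - 1 :=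
      end_ext fun q => by
        rw [endMap_one_tmul, LinearMap.sub_apply, LinearMap.sub_apply, map_sub, GLf.toEnd_map,
          endMap_one_tmul]
        simp
    rw [this]
    exact (commute_sub_one_iff _ _).trans ⟨fun h => GLf.ext h, fun h => congrArg GLf.toEnd h⟩
  · induction w with
    | zero => simp
    | add a b ha hb => rw [map_add, map_add, ha, hb]
    | tmul s v =>
      have h1 := h v.1 v.2
      rw [LinearMap.sub_apply, Module.End.one_apply, sub_eq_zero] at h1
      have h2 : inclMap V S (s ⊗ₜ[k] v) = s • ((1 : S) ⊗ₜ[k] (v : Q)) := by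
        simp [inclMap, TensorProduct.smul_tmul']
      rw [h2, map_smul, h1]
  · rw [LinearMap.sub_apply, Module.End.one_apply, sub_eq_zero]
    simpa [inclMap] using h ((1 : S) ⊗ₜ[k] ⟨v, hv⟩)

/-- The `S`-points of `U = 1_Q + J_V`, as a subgroup of `GL_k(Q)(S)`. -/
noncomputable def unipotentU [FiniteDimensional k Q] (ρ : N.toKGroup ⟶ GLf k Q)
    (V : Submodule k Q) (S : CommAlgCat.{u} k) : Subgroup ((GLf k Q).obj S) where
  carrier := {x | GLf.toEnd x - 1 ∈ annJPoints ρ V S}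
  mul_mem' {x y} hx hy := by
    rw [Set.mem_ofPred_eq, mem_one_add_iff] at *
    refine ⟨fun T f n => ?_, fun w => ?_⟩
    · rw [map_mul]
      exact (hx.1 T f n).mul_left (hy.1 T f n)
    · rw [GLf.toEnd_mul, Module.End.mul_apply, hy.2, hx.2]
  one_mem' := by
    rw [Set.mem_ofPred_eq, mem_one_add_iff]
    exact ⟨fun T f n => by rw [map_one]; exact Commute.one_left _, fun w => rfl⟩
  inv_mem' {x} hx := by
    rw [Set.mem_ofPred_eq, mem_one_add_iff] at *
    refine ⟨fun T f n => ?_, fun w => ?_⟩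
    · rw [map_inv]
      exact (hx.1 T f n).inv_left
    · conv_lhs => rw [← hx.2 w]
      rw [← Module.End.mul_apply, ← GLf.toEnd_mul, inv_mul_cancel]
      rfl

section Schreier

variable [FiniteDimensional k Q] {ρ : N.toKGroup ⟶ GLf k Q} {V : Submodule k Q}
  {ρV : G ⟶ GLf k V} {α : G.points ⟶ (GLf k Q).points}

theorem mem_unipotentU_iff {S : CommAlgCat.{u} k} (x : (GLf k Q).obj S) :
    x ∈ unipotentU ρ V S ↔
      (∀ (T : CommAlgCat.{u} k) (f : S ⟶ T) (n : N.toKGroup.obj T),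
        Commute ((GLf k Q).map f x) (pt ρ n)) ∧
      ∀ w : S ⊗[k] V, GLf.toEnd x (inclMap V S w) = inclMap V S w :=
  mem_one_add_iff x

theorem unipotentU_map {S T : CommAlgCat.{u} k} (f : S ⟶ T) {x : (GLf k Q).obj S}
    (hx : x ∈ unipotentU ρ V S) : (GLf k Q).map f x ∈ unipotentU ρ V T := by
  rw [mem_unipotentU_iff] at *
  refine ⟨fun W g n => ?_, fun w => ?_⟩
  · have h := hx.1 W (f ≫ g) n
    rwa [Functor.map_comp, ConcreteCategory.comp_apply] at h
  · induction w with
    | zero => simp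
    | add a b ha hb => rw [map_add, map_add, ha, hb]
    | tmul s v =>
      have h1 := congrArg (changeMap Q f) (hx.2 ((1 : S) ⊗ₜ[k] v))
      rw [← endMap_changeMap, ← GLf.toEnd_map] at h1
      have h2 : inclMap V T (s ⊗ₜ[k] v) = s • changeMap Q f (inclMap V S ((1 : S) ⊗ₜ[k] v)) := by
        simp [inclMap, TensorProduct.smul_tmul']
      rw [h2, map_smul, h1]

namespace IsStructureMap

theorem toEnd_inv_inclMap (hα : IsStructureMap ρ V ρV α) {S : CommAlgCat.{u} k} (g : G.obj S) (w : S ⊗[k] V) :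
    GLf.toEnd (val α g)⁻¹ (inclMap V S w) = inclMap V S (GLf.toEnd (pt ρV g)⁻¹ w) := by
  have h : inclMap V S w = GLf.toEnd (val α g) (inclMap V S (GLf.toEnd (pt ρV g)⁻¹ w)) := by
    rw [hα.restrict, ← Module.End.mul_apply, ← GLf.toEnd_mul, mul_inv_cancel]
    rfl
  conv_lhs => rw [h]
  rw [← Module.End.mul_apply, ← GLf.toEnd_mul, inv_mul_cancel]
  rfl

end IsStructureMap

/-! ### The Schreier system of a structure map and the extension group -/

namespace IsStructureMap

theorem pt_conj (hα : IsStructureMap ρ V ρV α) {S : CommAlgCat.{u} k} (g : G.obj S) (n : N.toKGroup.obj S) :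
    pt ρ (N.conj g n) = val α g * pt ρ n * (val α g)⁻¹ := by
  rw [hα.intertwine, mul_assoc, mul_inv_cancel, mul_one]

theorem conj_conj_inv {S : CommAlgCat.{u} k} (g : G.obj S) (n : N.toKGroup.obj S) :
    N.conj g (N.conj g⁻¹ n) = n := by
  refine Subtype.ext ?_
  change g * (g⁻¹ * pt N.incl n * g⁻¹⁻¹) * g⁻¹ = pt N.incl n
  group

theorem conj_mem (hα : IsStructureMap ρ V ρV α) {S : CommAlgCat.{u} k} (g : G.obj S) {x : (GLf k Q).obj S}
    (hx : x ∈ unipotentU ρ V S) : val α g * x * (val α g)⁻¹ ∈ unipotentU ρ V S := by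
  rw [mem_unipotentU_iff] at *
  refine ⟨fun T f n => ?_, fun w => ?_⟩
  · have h := hx.1 T f (N.conj (G.map f g)⁻¹ n)
    rw [map_mul, map_mul, map_inv, val_map]
    rw [← conj_conj_inv (G.map f g) n, hα.pt_conj]
    exact (Commute.conj_iff _).mpr h
  · rw [GLf.toEnd_mul, GLf.toEnd_mul, Module.End.mul_apply, Module.End.mul_apply,
      hα.toEnd_inv_inclMap, hx.2, ← hα.toEnd_inv_inclMap, ← Module.End.mul_apply,
      ← GLf.toEnd_mul, mul_inv_cancel]
    rfl

theorem factor_mem (hα : IsStructureMap ρ V ρV α) {S : CommAlgCat.{u} k} (g h : G.obj S) :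
    val α g * val α h * (val α (g * h))⁻¹ ∈ unipotentU ρ V S := by
  rw [mem_unipotentU_iff]
  refine ⟨fun T f n => ?_, fun w => ?_⟩
  · rw [map_mul, map_mul, map_inv, val_map, val_map, val_map, map_mul]
    generalize G.map f g = g'
    generalize G.map f h = h'
    have h1 : n = N.conj g' (N.conj h' (N.conj (g' * h')⁻¹ n)) := by
      refine Subtype.ext ?_
      change pt N.incl n =
        g' * (h' * ((g' * h')⁻¹ * pt N.incl n * (g' * h')⁻¹⁻¹) * h'⁻¹) * g'⁻¹
      group
    have h2 : pt ρ n = val α g' * (val α h' * pt ρ (N.conj (g' * h')⁻¹ n) * (val α h')⁻¹) *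
        (val α g')⁻¹ := by
      conv_lhs => rw [h1]
      rw [hα.pt_conj, hα.pt_conj]
    have h3 : pt ρ n = val α (g' * h') * pt ρ (N.conj (g' * h')⁻¹ n) *
        (val α (g' * h'))⁻¹ := by
      conv_lhs => rw [← conj_conj_inv (g' * h') n]
      rw [hα.pt_conj]
    change _ * _ = _ * _
    conv_lhs => rw [h3]
    conv_rhs => rw [h2]
    group
  · rw [GLf.toEnd_mul, GLf.toEnd_mul, Module.End.mul_apply, Module.End.mul_apply,
      hα.toEnd_inv_inclMap, hα.restrict, hα.restrict, ← Module.End.mul_apply,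
      ← Module.End.mul_apply, ← GLf.toEnd_mul, ← GLf.toEnd_mul, pt_mul, mul_inv_cancel]
    rfl

/-- The conjugation action `κ(g, u) = α(g) u α(g)⁻¹` of `G` on `U`. -/
noncomputable def kappa (hα : IsStructureMap ρ V ρV α) {S : CommAlgCat.{u} k} (g : G.obj S) (x : unipotentU ρ V S) :
    unipotentU ρ V S :=
  ⟨val α g * x.1 * (val α g)⁻¹, hα.conj_mem g x.2⟩

/-- The factor set `γ(g, h) = α(g) α(h) α(gh)⁻¹` with values in `U`. -/
noncomputable def gamma (hα : IsStructureMap ρ V ρV α) {S : CommAlgCat.{u} k} (g h : G.obj S) : unipotentU ρ V S :=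
  ⟨val α g * val α h * (val α (g * h))⁻¹, hα.factor_mem g h⟩

end IsStructureMap

/-- The `S`-points of the extension group of `G` by `U`: the set `U(S) × G(S)`. -/
@[ext]
structure DiamondPoints (hα : IsStructureMap ρ V ρV α) (S : CommAlgCat.{u} k) where
  /-- The component in `U`. -/
  fst : unipotentU ρ V S
  /-- The component in `G`. -/
  snd : G.obj S

namespace DiamondPoints

variable {hα : IsStructureMap ρ V ρV α} {S T : CommAlgCat.{u} k}

noncomputable instance : Mul (DiamondPoints hα S) :=
  ⟨fun x y => ⟨x.fst * hα.kappa x.snd y.fst * hα.gamma x.snd y.snd, x.snd * y.snd⟩⟩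

noncomputable instance : One (DiamondPoints hα S) := ⟨⟨1, 1⟩⟩

noncomputable instance : Inv (DiamondPoints hα S) :=
  ⟨fun x => ⟨(hα.gamma x.snd⁻¹ x.snd)⁻¹ * (hα.kappa x.snd⁻¹ x.fst)⁻¹, x.snd⁻¹⟩⟩

/-- The action of `(u, g)` on `S ⊗ Q` as `u α(g)`. -/
noncomputable def act (x : DiamondPoints hα S) : (GLf k Q).obj S := x.fst.1 * val α x.snd

theorem ext_act {x y : DiamondPoints hα S} (h1 : x.act = y.act) (h2 : x.snd = y.snd) : x = y := by
  refine DiamondPoints.ext (Subtype.ext ?_) h2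
  rw [act, act, h2] at h1
  exact mul_right_cancel h1

@[simp] theorem snd_mul (x y : DiamondPoints hα S) : (x * y).snd = x.snd * y.snd := rfl
@[simp] theorem snd_one : (1 : DiamondPoints hα S).snd = 1 := rfl
@[simp] theorem snd_inv (x : DiamondPoints hα S) : x⁻¹.snd = x.snd⁻¹ := rfl

theorem act_mul (x y : DiamondPoints hα S) : (x * y).act = x.act * y.act := by
  change (x.fst.1 * (val α x.snd * y.fst.1 * (val α x.snd)⁻¹) *
    (val α x.snd * val α y.snd * (val α (x.snd * y.snd))⁻¹)) * val α (x.snd * y.snd) =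
    x.fst.1 * val α x.snd * (y.fst.1 * val α y.snd)
  group

theorem act_one : (1 : DiamondPoints hα S).act = 1 := by
  change 1 * val α (1 : G.obj S) = 1
  rw [hα.val_one, one_mul]

theorem act_inv_mul (x : DiamondPoints hα S) : (x⁻¹ * x).act = 1 := by
  rw [act_mul]
  change ((val α x.snd⁻¹ * val α x.snd * (val α (x.snd⁻¹ * x.snd))⁻¹)⁻¹ *
    (val α x.snd⁻¹ * x.fst.1 * (val α x.snd⁻¹)⁻¹)⁻¹) * val α x.snd⁻¹ *
    (x.fst.1 * val α x.snd) = 1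
  rw [inv_mul_cancel, hα.val_one]
  group

noncomputable instance : Group (DiamondPoints hα S) :=
  Group.ofLeftAxioms
    (fun x y z => ext_act (by simp only [act_mul, mul_assoc]) (mul_assoc _ _ _))
    (fun x => ext_act (by rw [act_mul, act_one, one_mul]) (one_mul _))
    (fun x => ext_act (by rw [act_inv_mul, act_one]) (inv_mul_cancel _))

/-- Functoriality of the points of the extension group. -/
noncomputable def map (f : S ⟶ T) (x : DiamondPoints hα S) : DiamondPoints hα T :=
  ⟨⟨(GLf k Q).map f x.fst.1, unipotentU_map f x.fst.2⟩, G.map f x.snd⟩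

theorem act_map (f : S ⟶ T) (x : DiamondPoints hα S) :
    (x.map f).act = (GLf k Q).map f x.act := by
  rw [act, act, map_mul, val_map]
  rfl

theorem map_mul' (f : S ⟶ T) (x y : DiamondPoints hα S) :
    (x * y).map f = x.map f * y.map f := by
  refine ext_act ?_ (map_mul (G.map f).hom _ _)
  rw [act_map, act_mul, act_mul, act_map, act_map, map_mul]

end DiamondPoints

/-- The extension `G^⋄ = G^⋄(Q, V, α)` of `G` by `U = 1_Q + J_V`: the `k`-functor `U × G` with
multiplication `(x, g)(y, h) = (x κ(g, y) γ(g, h), gh)`. -/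
noncomputable def diamond (hα : IsStructureMap ρ V ρV α) : KGroup k where
  obj S := GrpCat.of (DiamondPoints hα S)
  map f := GrpCat.ofHom
    { toFun := DiamondPoints.map f
      map_one' := DiamondPoints.ext_act
        (by rw [DiamondPoints.act_map, DiamondPoints.act_one, map_one, DiamondPoints.act_one])
        (map_one (G.map f).hom)
      map_mul' := DiamondPoints.map_mul' f }
  map_id _ := by
    ext x : 2
    refine DiamondPoints.ext_act ?_ ?_
    · change (DiamondPoints.map (𝟙 _) x).act = x.act
      rw [DiamondPoints.act_map]
      simp
    · change G.map (𝟙 _) x.snd = x.snd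
      simp
  map_comp f g := by
    ext x : 2
    refine DiamondPoints.ext_act ?_ ?_
    · change (DiamondPoints.map (f ≫ g) x).act = (DiamondPoints.map g (DiamondPoints.map f x)).act
      rw [DiamondPoints.act_map, DiamondPoints.act_map, DiamondPoints.act_map]
      simp
    · change G.map (f ≫ g) x.snd = G.map g (G.map f x.snd)
      simp

/-- The projection `π : G^⋄ → G`. -/
noncomputable def diamondProj (hα : IsStructureMap ρ V ρV α) : diamond hα ⟶ G where
  app _ := GrpCat.ofHom
    { toFun := DiamondPoints.snd
      map_one' := rfl
      map_mul' := fun _ _ => rfl }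
  naturality _ _ _ := rfl

namespace IsStructureMap

theorem val_incl (hα : IsStructureMap ρ V ρV α) {S : CommAlgCat.{u} k} (n : N.toKGroup.obj S) :
    val α (pt N.incl n) = pt ρ n := by
  have h := hα.val_mul (1 : G.obj S) n
  rwa [one_mul, hα.val_one, one_mul] at h

theorem act_iota (hα : IsStructureMap ρ V ρV α) {S : CommAlgCat.{u} k} (n : N.toKGroup.obj S) :
    (⟨1, pt N.incl n⟩ : DiamondPoints hα S).act = pt ρ n := by
  change 1 * val α (pt N.incl n) = pt ρ n
  rw [one_mul, hα.val_incl]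

end IsStructureMap

theorem DiamondPoints.act_comm_iota {hα : IsStructureMap ρ V ρV α} {S : CommAlgCat.{u} k}
    (x : DiamondPoints hα S) (n : N.toKGroup.obj S) :
    pt ρ (N.conj x.snd n) * x.act = x.act * pt ρ n := by
  have h := ((mem_unipotentU_iff _).mp x.fst.2).1 S (𝟙 S) (N.conj x.snd n)
  rw [CategoryTheory.Functor.map_id] at h
  have h' : x.fst.1 * pt ρ (N.conj x.snd n) = pt ρ (N.conj x.snd n) * x.fst.1 := h
  rw [act, ← mul_assoc, ← h', mul_assoc, ← hα.intertwine, mul_assoc]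

theorem DiamondPoints.iota_conj {hα : IsStructureMap ρ V ρV α} {S : CommAlgCat.{u} k}
    (x : DiamondPoints hα S) (n : N.toKGroup.obj S) :
    (⟨1, pt N.incl (N.conj x.snd n)⟩ : DiamondPoints hα S) = x * ⟨1, pt N.incl n⟩ * x⁻¹ := by
  rw [eq_mul_inv_iff_mul_eq]
  refine ext_act ?_ ?_
  · rw [act_mul, act_mul, hα.act_iota, hα.act_iota, act_comm_iota]
  · change x.snd * pt N.incl n * x.snd⁻¹ * x.snd = x.snd * pt N.incl n
    rw [inv_mul_cancel_right]

theorem DiamondPoints.iota_mul {hα : IsStructureMap ρ V ρV α} {S : CommAlgCat.{u} k}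
    (m n : N.toKGroup.obj S) :
    (⟨1, pt N.incl (m * n)⟩ : DiamondPoints hα S) = ⟨1, pt N.incl m⟩ * ⟨1, pt N.incl n⟩ :=
  ext_act (by rw [act_mul, hα.act_iota, hα.act_iota, hα.act_iota, pt_mul]) (pt_mul N.incl m n)

/-- The homomorphism `ι : N → G^⋄`, `n ↦ (1, n)`. -/
noncomputable def diamondIota (hα : IsStructureMap ρ V ρV α) : N.toKGroup ⟶ diamond hα where
  app S := GrpCat.ofHom
    { toFun := fun n => (⟨1, pt N.incl n⟩ : DiamondPoints hα S)
      map_one' := rfl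
      map_mul' := DiamondPoints.iota_mul }
  naturality S T f := by
    ext n : 2
    exact DiamondPoints.ext (Subtype.ext (map_one ((GLf k Q).map f).hom).symm) rfl

/-- The normal subgroup functor `ι(N)` of `G^⋄`. -/
noncomputable def diamondN (hα : IsStructureMap ρ V ρV α) :
    NormalSubgroupFunctor (diamond hα) where
  carrier S := ((diamondIota hα).app S).hom.range
  normal S := by
    refine ⟨?_⟩
    rintro _ ⟨n, rfl⟩ x
    exact ⟨N.conj x.snd n, DiamondPoints.iota_conj x n⟩
  map_mem {S T} f g hg := by
    obtain ⟨n, rfl⟩ := hg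
    exact ⟨N.toKGroup.map f n, (pt_map (diamondIota hα) f n).symm⟩

end Schreier
end Stable

/-! ### The fppf topology and quotients of group functors -/

section Quotient

theorem exists_prime_tensor {S T Z : Type u} [CommRing S] [CommRing T] [CommRing Z] [Algebra S T]
    [Algebra S Z] (p : PrimeSpectrum Z) (r : PrimeSpectrum T)
    (h : PrimeSpectrum.comap (algebraMap S T) r = PrimeSpectrum.comap (algebraMap S Z) p) :
    ∃ w : PrimeSpectrum (Z ⊗[S] T),
      PrimeSpectrum.comap (algebraMap Z (Z ⊗[S] T)) w = p := by
  rw [← Set.mem_range, ← PrimeSpectrum.nontrivial_iff_mem_rangeComap]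
  have hr : Nontrivial ((PrimeSpectrum.comap (algebraMap S Z) p).asIdeal.ResidueField ⊗[S] T) :=
    (PrimeSpectrum.nontrivial_iff_mem_rangeComap _).mpr ⟨r, h⟩
  let F := (PrimeSpectrum.comap (algebraMap S Z) p).asIdeal.ResidueField
  let L := p.asIdeal.ResidueField
  let φ : F →ₐ[S] L := Ideal.ResidueField.mapₐ _ _ (Algebra.ofId S Z) rfl
  let : Algebra F L := φ.toRingHom.toAlgebra
  have : IsScalarTower S F L := IsScalarTower.of_algebraMap_eq' φ.comp_algebraMap.symm
  have : Nontrivial (F ⊗[S] T) := hr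
  have : Nontrivial (L ⊗[F] (F ⊗[S] T)) := inferInstance
  have : Nontrivial (L ⊗[S] T) :=
    (TensorProduct.AlgebraTensorModule.cancelBaseChange S F L L T).symm.toEquiv.nontrivial
  exact (TensorProduct.AlgebraTensorModule.cancelBaseChange S Z L L T).toEquiv.nontrivial

/-- The fppf topology on the category of affine `k`-schemes, the opposite of that of commutative
`k`-algebras: a sieve covers `Spec S` when it contains a finite family `Spec T_i → Spec S` of flat,
finitely presented maps whose images cover `Spec S`. -/
def fppfTopology (k : Type u) [Field k] : GrothendieckTopology (CommAlgCat.{u} k)ᵒᵖ where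
  sieves X := {R | ∃ (ι : Type) (_ : Finite ι) (Y : ι → (CommAlgCat.{u} k)ᵒᵖ)
    (f : ∀ i, Y i ⟶ X),
      (∀ i, R (f i) ∧ (f i).unop.hom.toRingHom.Flat ∧
        (f i).unop.hom.toRingHom.FinitePresentation) ∧
      ∀ p : PrimeSpectrum X.unop, ∃ (i : ι) (r : PrimeSpectrum (Y i).unop),
        PrimeSpectrum.comap (f i).unop.hom.toRingHom r = p}
  top_mem' X := ⟨Unit, inferInstance, fun _ => X, fun _ => 𝟙 X, fun _ =>
    ⟨trivial, RingHom.Flat.id _, RingHom.FinitePresentation.id _⟩, fun p => ⟨(), p, rfl⟩⟩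
  pullback_stable' X Z R g := by
    rintro ⟨ι, hι, Y, f, h1, h2⟩
    let : Algebra X.unop Z.unop := g.unop.hom.toRingHom.toAlgebra
    let := fun i => (f i).unop.hom.toRingHom.toAlgebra
    have : IsScalarTower k X.unop Z.unop :=
      IsScalarTower.of_algebraMap_eq' g.unop.hom.comp_algebraMap.symm
    have := fun i => IsScalarTower.of_algebraMap_eq' (f i).unop.hom.comp_algebraMap.symm
    let W : ι → (CommAlgCat.{u} k)ᵒᵖ := fun i =>
      Opposite.op (CommAlgCat.of k (Z.unop ⊗[X.unop] (Y i).unop))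
    let a : ∀ i, W i ⟶ Z := fun i => Quiver.Hom.op (CommAlgCat.ofHom
      (IsScalarTower.toAlgHom k Z.unop (Z.unop ⊗[X.unop] (Y i).unop)))
    let b : ∀ i, W i ⟶ Y i := fun i => Quiver.Hom.op (CommAlgCat.ofHom
      ((Algebra.TensorProduct.includeRight :
        (Y i).unop →ₐ[X.unop] Z.unop ⊗[X.unop] (Y i).unop).restrictScalars k))
    refine ⟨ι, hι, W, a, fun i => ⟨?_, ?_, ?_⟩, fun p => ?_⟩
    · have hab : a i ≫ g = b i ≫ f i := by
        refine Quiver.Hom.unop_inj (CommAlgCat.hom_ext (AlgHom.ext fun x => ?_))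
        change (algebraMap X.unop Z.unop x) ⊗ₜ[X.unop] (1 : (Y i).unop) =
          (1 : Z.unop) ⊗ₜ[X.unop] (algebraMap X.unop (Y i).unop x)
        rw [Algebra.algebraMap_eq_smul_one, Algebra.algebraMap_eq_smul_one,
          TensorProduct.smul_tmul]
      change R (a i ≫ g)
      rw [hab]
      exact R.downward_closed (h1 i).1 _
    · have : Module.Flat X.unop (Y i).unop := (h1 i).2.1
      have : Module.Flat Z.unop (Z.unop ⊗[X.unop] (Y i).unop) := inferInstance
      exact RingHom.flat_algebraMap_iff.mpr this
    · have : Algebra.FinitePresentation X.unop (Y i).unop := (h1 i).2.2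
      have : Algebra.FinitePresentation Z.unop (Z.unop ⊗[X.unop] (Y i).unop) := inferInstance
      exact RingHom.finitePresentation_algebraMap.mpr this
    · obtain ⟨i, r, hr⟩ := h2 (PrimeSpectrum.comap g.unop.hom.toRingHom p)
      obtain ⟨w, hw⟩ := exists_prime_tensor (S := X.unop) (T := (Y i).unop) (Z := Z.unop) p r hr
      exact ⟨i, w, hw⟩
  transitive' X R := by
    rintro ⟨ι, hι, Y, f, h1, h2⟩ R' h
    choose κ hκ Z g h3 h4 using fun i => h (h1 i).1
    refine ⟨Σ i, κ i, inferInstance, fun j => Z j.1 j.2, fun j => g j.1 j.2 ≫ f j.1,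
      fun j => ⟨(h3 j.1 j.2).1, ?_, ?_⟩, fun p => ?_⟩
    · exact RingHom.Flat.comp (h1 j.1).2.1 (h3 j.1 j.2).2.1
    · exact RingHom.FinitePresentation.comp (h3 j.1 j.2).2.2 (h1 j.1).2.2
    · obtain ⟨i, r, hr⟩ := h2 p
      obtain ⟨j, s, hs⟩ := h4 i r
      refine ⟨⟨i, j⟩, s, ?_⟩
      rw [← hr, ← hs]
      rfl

instance : HasFilteredColimits GrpCat.{u} where
  HasColimitsOfShape _ _ _ :=
    ⟨fun F => ⟨⟨⟨_, GrpCat.FilteredColimits.colimitCoconeIsColimit F⟩⟩⟩⟩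

variable {k : Type u} [Field k] {G H : KGroup k}

namespace NormalSubgroupFunctor

/-- The functor `S ↦ G(S) / N(S)`. -/
def naiveQuotient (N : NormalSubgroupFunctor G) : KGroup k where
  obj S := GrpCat.of (G.obj S ⧸ N.carrier S)
  map {S T} f := GrpCat.ofHom
    (QuotientGroup.map (N.carrier S) (N.carrier T) (G.map f).hom fun _ hg => N.map_mem f hg)
  map_id S := by
    ext x
    change ((G.map (𝟙 S) x : G.obj S) : G.obj S ⧸ N.carrier S) = x
    simp
  map_comp {S T W} f g := by
    ext x
    change ((G.map (f ≫ g) x : G.obj W) : G.obj W ⧸ N.carrier W) =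
      ((G.map g (G.map f x) : G.obj W) : G.obj W ⧸ N.carrier W)
    simp

/-- The quotient `G / N`: the sheaf of groups associated with `S ↦ G(S) / N(S)` for the fppf
topology. (The values are moved one universe up so that the associated sheaf exists.) -/
noncomputable def quotient (N : NormalSubgroupFunctor G) :
    Sheaf (fppfTopology k) GrpCat.{u + 1} :=
  (presheafToSheaf (fppfTopology k) GrpCat.{u + 1}).obj
    (unopUnop (CommAlgCat.{u} k) ⋙ N.naiveQuotient ⋙ GrpCat.uliftFunctor.{u + 1, u})

/-- A homomorphism `φ : G → H` with `φ(N) ⊆ M` induces `S ↦ (G(S) / N(S) → H(S) / M(S))`. -/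
def naiveQuotientMap (N : NormalSubgroupFunctor G) (M : NormalSubgroupFunctor H) (φ : G ⟶ H)
    (h : ∀ (S : CommAlgCat.{u} k) (n : G.obj S), n ∈ N.carrier S → pt φ n ∈ M.carrier S) :
    N.naiveQuotient ⟶ M.naiveQuotient where
  app S := GrpCat.ofHom (QuotientGroup.map (N.carrier S) (M.carrier S) (φ.app S).hom (h S))
  naturality S T f := by
    ext x
    obtain ⟨g, rfl⟩ := QuotientGroup.mk_surjective x
    exact congrArg (QuotientGroup.mk (s := M.carrier T)) (pt_map φ f g).symm

/-- The homomorphism `G / N → H / M` induced by a homomorphism `φ : G → H` with `φ(N) ⊆ M`. -/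
noncomputable def quotientMap (N : NormalSubgroupFunctor G) (M : NormalSubgroupFunctor H)
    (φ : G ⟶ H)
    (h : ∀ (S : CommAlgCat.{u} k) (n : G.obj S), n ∈ N.carrier S → pt φ n ∈ M.carrier S) :
    N.quotient ⟶ M.quotient :=
  (presheafToSheaf (fppfTopology k) GrpCat.{u + 1}).map
    (Functor.whiskerLeft (unopUnop (CommAlgCat.{u} k))
      (Functor.whiskerRight (naiveQuotientMap N M φ h) GrpCat.uliftFunctor.{u + 1, u}))

end NormalSubgroupFunctor

variable {N : NormalSubgroupFunctor G} {Q : Type u} [AddCommGroup Q] [Module k Q]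
  [FiniteDimensional k Q] {ρ : N.toKGroup ⟶ GLf k Q} {V : Submodule k Q}
  {ρV : G ⟶ GLf k V} {α : G.points ⟶ (GLf k Q).points}

/-- The projection `G^⋄ / ι(N) → G / N` induced by `π`. -/
noncomputable def diamondQuotientProj (hα : IsStructureMap ρ V ρV α) :
    (diamondN hα).quotient ⟶ N.quotient :=
  (diamondN hα).quotientMap N (diamondProj hα) (by
    rintro S _ ⟨n, rfl⟩
    exact (show N.carrier S from n).2)

end Quotient

end KGroups

open KGroups

/-!
A splitting `σ : G → G^⋄` composed with the representation `(u, g) ↦ u α(g)` of `G^⋄` on `Q`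
(`diamondAct`) is an extension of the action of `N` that agrees with the given one on `V`.
Conversely, for such an extension `ρ_G`, the points `ρ_G(g)` and `α(g)` conjugate `ρ(N)` in the same
way and agree on `V`, so `ρ_G(g) α(g)⁻¹` lies in `U` and `g ↦ (ρ_G(g) α(g)⁻¹, g)` is a splitting
(`exists_section_of_extension`). A splitting that extends `ι` maps `N` into `ι(N)`, so it induces a
splitting of `G^⋄ / ι(N) → G / N`.

For the remaining implication, `π` maps `ι(N)` isomorphically onto `N`, so the square formed by
`G^⋄ → G` and `G^⋄ / ι(N) → G / N` is cartesian for fppf sheaves, and a section of its lower edge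
pulls back to one of its upper edge (`exists_section_of_quotient_section`). In terms of points:
given `g ∈ G(S)` and a splitting `σ` of the quotients, there is a unique `x ∈ G^⋄(S)` over `g`
whose class modulo `ι(N)` is `σ(gN)`. Such an `x` exists fppf-locally, as one can correct a
representative of `σ(gN)` by a point of `ι(N)`; it is unique because `ι(N)` meets the kernel of
`π` trivially; and the local solutions glue because `G^⋄` is an fppf sheaf. The sheaf property
(`isFppfSheaf_diamond`) is reduced to that of `G` and of `GL_k(Q)`, and these to faithfully flat
descent for elements of rings (`ring_exists_glue`).
-/

namespace KGroups

/-! ### Faithfully flat descent for affine schemes -/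

/-- For a finite family of `S`-algebras, `(∏ T_i) ⊗ (∏ T_i)` embeds into `∏ T_i ⊗ T_j`. -/
theorem tensor_pi_ext {S ι : Type*} [CommRing S] [Finite ι] {T : ι → Type*}
    [∀ i, CommRing (T i)] [∀ i, Algebra S (T i)] {x y : (∀ i, T i) ⊗[S] (∀ i, T i)}
    (h : ∀ i j, Algebra.TensorProduct.map (Pi.evalAlgHom S T i) (Pi.evalAlgHom S T j) x =
      Algebra.TensorProduct.map (Pi.evalAlgHom S T i) (Pi.evalAlgHom S T j) y) : x = y := by
  classical
  have := Fintype.ofFinite ι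
  refine (Algebra.TensorProduct.piRight S S (∀ i, T i) T).injective (funext fun j => ?_)
  refine (Algebra.TensorProduct.comm S (∀ i, T i) (T j)).injective ?_
  refine (Algebra.TensorProduct.piRight S S (T j) T).injective (funext fun i => ?_)
  refine (Algebra.TensorProduct.comm S (T j) (T i)).injective ?_
  have key : ∀ z : (∀ i, T i) ⊗[S] (∀ i, T i),
      Algebra.TensorProduct.comm S (T j) (T i) (Algebra.TensorProduct.piRight S S (T j) T
        (Algebra.TensorProduct.comm S (∀ i, T i) (T j)
          (Algebra.TensorProduct.piRight S S (∀ i, T i) T z j)) i) =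
      Algebra.TensorProduct.map (Pi.evalAlgHom S T i) (Pi.evalAlgHom S T j) z := by
    intro z
    induction z with
    | zero => simp
    | add a b ha hb => simpa using congrArg₂ (· + ·) ha hb
    | tmul a b => rfl
  rw [key, key, h]

theorem faithfullyFlat_pi {S ι : Type*} [CommRing S] [Finite ι] {T : ι → Type*}
    [∀ i, CommRing (T i)] [∀ i, Algebra S (T i)] [∀ i, Module.Flat S (T i)]
    (h : ∀ p : PrimeSpectrum S, ∃ (i : ι) (r : PrimeSpectrum (T i)),
      PrimeSpectrum.comap (algebraMap S (T i)) r = p) :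
    Module.FaithfullyFlat S (∀ i, T i) := by
  classical
  have := Fintype.ofFinite ι
  have : Module.Flat S (∀ i, T i) :=
    Module.Flat.of_linearEquiv (DFinsupp.linearEquivFunOnFintype (R := S) (M := T)).symm
  refine Module.FaithfullyFlat.of_comap_surjective fun p => ?_
  obtain ⟨i, r, rfl⟩ := h p
  exact ⟨PrimeSpectrum.comap (Pi.evalRingHom T i) r, rfl⟩

/-- A set-valued functor `F` on commutative `k`-algebras is an fppf sheaf: elements of `F(S)` are
determined by their images in the members of a covering sieve of `Spec S`, and compatible families
over such a sieve glue. -/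
structure IsFppfSheaf {k : Type u} [Field k] (F : CommAlgCat.{u} k ⥤ Type u) : Prop where
  eq_of_locally_eq {S : CommAlgCat.{u} k} {R : Sieve (Opposite.op S)} {s t : F.obj S}
    (hR : R ∈ fppfTopology k (Opposite.op S))
    (h : ∀ (T : CommAlgCat.{u} k) (f : S ⟶ T), R f.op → F.map f s = F.map f t) : s = t
  exists_glue {S : CommAlgCat.{u} k} {R : Sieve (Opposite.op S)}
    (hR : R ∈ fppfTopology k (Opposite.op S))
    (x : ∀ (T : CommAlgCat.{u} k) (f : S ⟶ T), R f.op → F.obj T)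
    (hx : ∀ (T W : CommAlgCat.{u} k) (f : S ⟶ T) (hf : R f.op) (g : T ⟶ W),
      F.map g (x T f hf) = x W (f ≫ g) (R.downward_closed hf g.op)) :
    ∃ s : F.obj S, ∀ (T : CommAlgCat.{u} k) (f : S ⟶ T) (hf : R f.op), F.map f s = x T f hf

variable {k : Type u} [Field k] {S : CommAlgCat.{u} k}

/-- The structure presheaf `S ↦ S` is separated: the product of a finite flat cover is faithfully
flat over `S`, so `S` embeds into it. -/
theorem ring_eq_of_locally_eq {R : Sieve (Opposite.op S)} {s t : S}
    (hR : R ∈ fppfTopology k (Opposite.op S))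
    (h : ∀ (T : CommAlgCat.{u} k) (f : S ⟶ T), R f.op → f.hom s = f.hom t) : s = t := by
  obtain ⟨ι, _, Y, f, h1, h2⟩ := hR
  let := fun i => (f i).unop.hom.toRingHom.toAlgebra
  have (i : ι) : Module.Flat S (Y i).unop := (h1 i).2.1
  have := faithfullyFlat_pi (S := S) (T := fun i => (Y i).unop) h2
  exact FaithfulSMul.algebraMap_injective S (∀ i, (Y i).unop)
    (funext fun i => h _ (f i).unop (h1 i).1)

/-- Gluing for `S ↦ S`: with `T = ∏ T_i` for a finite flat cover, this is exactness of
`S → T ⇉ T ⊗[S] T`. -/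
theorem ring_exists_glue {R : Sieve (Opposite.op S)}
    (hR : R ∈ fppfTopology k (Opposite.op S))
    (x : ∀ (T : CommAlgCat.{u} k) (f : S ⟶ T), R f.op → T)
    (hx : ∀ (T W : CommAlgCat.{u} k) (f : S ⟶ T) (hf : R f.op) (g : T ⟶ W),
      g.hom (x T f hf) = x W (f ≫ g) (R.downward_closed hf g.op)) :
    ∃ s : S, ∀ (T : CommAlgCat.{u} k) (f : S ⟶ T) (hf : R f.op), f.hom s = x T f hf := by
  obtain ⟨ι, hι, Y, f, h1, h2⟩ := id hR
  let := fun i => (f i).unop.hom.toRingHom.toAlgebra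
  have (i : ι) : IsScalarTower k S (Y i).unop :=
    IsScalarTower.of_algebraMap_eq' (f i).unop.hom.comp_algebraMap.symm
  have (i : ι) : Module.Flat S (Y i).unop := (h1 i).2.1
  have := faithfullyFlat_pi (S := S) (T := fun i => (Y i).unop) h2
  let z : ∀ i, (Y i).unop := fun i => x _ (f i).unop (h1 i).1
  have hzmap (i : ι) {W : CommAlgCat.{u} k} (g : (Y i).unop ⟶ W) : g.hom (z i) =
      x W ((f i).unop ≫ g) (R.downward_closed (h1 i).1 g.op) := hx _ _ _ _ g
  have hz : Algebra.TensorProduct.includeLeftSubRight S (∀ i, (Y i).unop) z = 0 := by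
    rw [Algebra.TensorProduct.includeLeftSubRight_apply, sub_eq_zero]
    refine tensor_pi_ext fun i j => ?_
    let W : CommAlgCat.{u} k := CommAlgCat.of k ((Y i).unop ⊗[S] (Y j).unop)
    let a : (Y i).unop ⟶ W := CommAlgCat.ofHom
      ((Algebra.TensorProduct.includeLeft :
        (Y i).unop →ₐ[S] (Y i).unop ⊗[S] (Y j).unop).restrictScalars k)
    let b : (Y j).unop ⟶ W := CommAlgCat.ofHom
      ((Algebra.TensorProduct.includeRight :
        (Y j).unop →ₐ[S] (Y i).unop ⊗[S] (Y j).unop).restrictScalars k)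
    have hab : (f i).unop ≫ a = (f j).unop ≫ b := by
      refine CommAlgCat.hom_ext (AlgHom.ext fun s => ?_)
      change algebraMap S (Y i).unop s ⊗ₜ[S] (1 : (Y j).unop) =
        (1 : (Y i).unop) ⊗ₜ[S] algebraMap S (Y j).unop s
      rw [Algebra.algebraMap_eq_smul_one, Algebra.algebraMap_eq_smul_one,
        TensorProduct.smul_tmul]
    have e1 : a.hom (z i) = b.hom (z j) := by
      rw [hzmap, hzmap]
      congr 1
    rw [Algebra.TensorProduct.map_tmul, Algebra.TensorProduct.map_tmul, map_one, map_one]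
    exact e1
  obtain ⟨s, hs⟩ := (Algebra.IsEffective.of_faithfullyFlat S (∀ i, (Y i).unop) z).mp hz
  have hs' (i : ι) : (f i).unop.hom s = z i := congrFun hs i
  refine ⟨s, fun T g hg => ?_⟩
  -- On the pullback along `g` of the sieve generated by the finite family, both sides come from
  -- some `z i`.
  have hmem : Sieve.generate (Presieve.ofArrows Y f) ∈ fppfTopology k (Opposite.op S) :=
    ⟨ι, hι, Y, f, fun i => ⟨Sieve.le_generate _ _ _ (.mk i), (h1 i).2⟩, h2⟩
  refine ring_eq_of_locally_eq ((fppfTopology k).pullback_stable g.op hmem) fun W h hW => ?_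
  obtain ⟨_, c, _, ⟨i⟩, hc⟩ := hW
  have hc' : (f i).unop ≫ c.unop = g ≫ h := congrArg Quiver.Hom.unop hc
  rw [hx _ _ _ hg]
  have e2 : h.hom (g.hom s) = c.unop.hom ((f i).unop.hom s) :=
    (congrArg (fun m : S ⟶ W => m.hom s) hc').symm
  rw [e2, hs', hzmap]
  congr 1

theorem isFppfSheaf_forget : IsFppfSheaf (forget (CommAlgCat.{u} k)) :=
  ⟨ring_eq_of_locally_eq, ring_exists_glue⟩

/-- A functor is an fppf sheaf as soon as it has a jointly injective family of maps to fppf sheaves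
whose image is cut out by a condition that is local for the topology. -/
theorem IsFppfSheaf.of_local {F : CommAlgCat.{u} k ⥤ Type u} {I : Type*}
    {E : I → CommAlgCat.{u} k ⥤ Type u} (hE : ∀ i, IsFppfSheaf (E i)) (e : ∀ i, F ⟶ E i)
    (inj : ∀ (S : CommAlgCat.{u} k) (s t : F.obj S),
      (∀ i, (e i).app S s = (e i).app S t) → s = t)
    (loc : ∀ (S : CommAlgCat.{u} k) (R : Sieve (Opposite.op S)),
      R ∈ fppfTopology k (Opposite.op S) → ∀ y : ∀ i, (E i).obj S,
      (∀ (T : CommAlgCat.{u} k) (f : S ⟶ T), R f.op →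
        ∃ x : F.obj T, ∀ i, (e i).app T x = (E i).map f (y i)) →
      ∃ x : F.obj S, ∀ i, (e i).app S x = y i) : IsFppfSheaf F where
  eq_of_locally_eq hR h := inj _ _ _ fun i => (hE i).eq_of_locally_eq hR fun T f hf => by
    rw [← NatTrans.naturality_apply (e i), ← NatTrans.naturality_apply (e i), h T f hf]
  exists_glue {S R} hR x hx := by
    choose y hy using fun i => (hE i).exists_glue hR (fun T f hf => (e i).app T (x T f hf))
      (fun T W f hf g => by rw [← NatTrans.naturality_apply, hx])
    obtain ⟨s, hs⟩ := loc S R hR y fun T f hf => ⟨x T f hf, fun i => (hy i T f hf).symm⟩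
    refine ⟨s, fun T f hf => inj _ _ _ fun i => ?_⟩
    rw [NatTrans.naturality_apply, hs, hy]

/-- Affine `k`-schemes are fppf sheaves. A point of `Spec A` is recorded by its values at the
elements of `A`, and being a homomorphism of algebras is a local condition on such a family of
values. -/
theorem isFppfSheaf_of_corepresentableBy {F : CommAlgCat.{u} k ⥤ Type u} {A : CommAlgCat.{u} k}
    (r : F.CorepresentableBy A) : IsFppfSheaf F := by
  have hr {S T : CommAlgCat.{u} k} (f : S ⟶ T) (s : F.obj S) :
      r.homEquiv.symm (F.map f s) = r.homEquiv.symm s ≫ f :=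
    (r.homEquiv_symm_comp s f).symm
  refine IsFppfSheaf.of_local (I := A) (E := fun _ => forget (CommAlgCat.{u} k))
    (fun _ => isFppfSheaf_forget)
    (fun a => { app := fun S => ↾ fun s => (r.homEquiv.symm s).hom a
                naturality := fun S T f => by
                  ext s
                  change (r.homEquiv.symm (F.map f s)).hom a = f.hom ((r.homEquiv.symm s).hom a)
                  rw [hr]
                  rfl }) ?_ ?_
  · intro S s t h
    refine r.homEquiv.symm.injective (CommAlgCat.hom_ext (AlgHom.ext h))
  · intro S R hR y hy
    change A → S at y
    choose x hx using hy
    replace hx : ∀ (T : CommAlgCat.{u} k) (f : S ⟶ T) (hf : R f.op) (a : A),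
      f.hom (y a) = (r.homEquiv.symm (x T f hf)).hom a := fun T f hf a => (hx T f hf a).symm
    let φ : A →ₐ[k] S :=
      { toFun := y
        map_one' := ring_eq_of_locally_eq hR fun T f hf => by simp [hx T f hf]
        map_mul' := fun a b => ring_eq_of_locally_eq hR fun T f hf => by simp [hx T f hf]
        map_zero' := ring_eq_of_locally_eq hR fun T f hf => by simp [hx T f hf]
        map_add' := fun a b => ring_eq_of_locally_eq hR fun T f hf => by simp [hx T f hf]
        commutes' := fun a => ring_eq_of_locally_eq hR fun T f hf => by simp [hx T f hf] }
    refine ⟨r.homEquiv (CommAlgCat.ofHom φ), fun a => ?_⟩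
    change (r.homEquiv.symm (r.homEquiv (CommAlgCat.ofHom φ))).hom a = y a
    rw [Equiv.symm_apply_apply]
    rfl

/-! ### Descent for the general linear group -/

section GeneralLinear

variable (Q : Type u) [AddCommGroup Q] [Module k Q]

/-- The functor `S ↦ S ⊗ Q`. -/
noncomputable def tensorFunctor : CommAlgCat.{u} k ⥤ Type u where
  obj S := S ⊗[k] Q
  map f := ↾ changeMap Q f
  map_id S := by
    ext x
    change changeMap Q (𝟙 S) x = x
    induction x with
    | zero => simp
    | add y z hy hz => rw [map_add, hy, hz]
    | tmul s q => rfl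
  map_comp f g := by
    ext x
    change changeMap Q (f ≫ g) x = changeMap Q g (changeMap Q f x)
    induction x with
    | zero => simp
    | add y z hy hz => rw [map_add, hy, hz, map_add, map_add]
    | tmul s q => rfl

theorem baseChange_repr_changeMap {ι : Type*} (b : Module.Basis ι k Q) {S T : CommAlgCat.{u} k}
    (f : S ⟶ T) (z : S ⊗[k] Q) (i : ι) :
    (b.baseChange T).repr (changeMap Q f z) i = f.hom ((b.baseChange S).repr z i) := by
  induction z with
  | zero => simp
  | add y z hy hz => simp only [map_add, Finsupp.add_apply, hy, hz]
  | tmul s q => simp [Module.Basis.baseChange_repr_tmul]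

theorem isFppfSheaf_tensorFunctor [FiniteDimensional k Q] :
    IsFppfSheaf (tensorFunctor (k := k) Q) := by
  let b := Module.finBasis k Q
  refine IsFppfSheaf.of_local (E := fun _ => forget (CommAlgCat.{u} k))
    (fun _ => isFppfSheaf_forget)
    (fun i => { app := fun S => ↾ fun z : S ⊗[k] Q => (b.baseChange S).repr z i
                naturality := fun S T f => by
                  ext z
                  exact baseChange_repr_changeMap Q b f z i }) ?_ ?_
  · intro S s t h
    exact (b.baseChange S).ext_elem h
  · intro S R hR y _
    refine ⟨(b.baseChange S).equivFun.symm y, fun i => ?_⟩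
    exact congrFun ((b.baseChange S).equivFun.apply_symm_apply y) i

variable {Q}

theorem changeMap_eq_of_locally_eq [FiniteDimensional k Q] {S : CommAlgCat.{u} k}
    {R : Sieve (Opposite.op S)} {y z : S ⊗[k] Q} (hR : R ∈ fppfTopology k (Opposite.op S))
    (h : ∀ (T : CommAlgCat.{u} k) (f : S ⟶ T), R f.op → changeMap Q f y = changeMap Q f z) :
    y = z :=
  (isFppfSheaf_tensorFunctor Q).eq_of_locally_eq hR h

theorem endMap_liftBaseChange {S T : CommAlgCat.{u} k} (f : S ⟶ T) {l : Q →ₗ[k] S ⊗[k] Q}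
    {x : Module.End T (T ⊗[k] Q)} (h : ∀ q, x ((1 : T) ⊗ₜ[k] q) = changeMap Q f (l q)) :
    endMap Q f (l.liftBaseChange S) = x :=
  end_ext fun q => by
    rw [endMap_one_tmul, h, LinearMap.liftBaseChange_tmul, one_smul]

theorem end_eq_of_locally_eq [FiniteDimensional k Q] {S : CommAlgCat.{u} k}
    {R : Sieve (Opposite.op S)} {y z : Module.End S (S ⊗[k] Q)}
    (hR : R ∈ fppfTopology k (Opposite.op S))
    (h : ∀ (T : CommAlgCat.{u} k) (f : S ⟶ T), R f.op → endMap Q f y = endMap Q f z) :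
    y = z :=
  end_ext fun q => changeMap_eq_of_locally_eq hR fun T f hf => by
    rw [← endMap_one_tmul, ← endMap_one_tmul, h T f hf]

theorem end_exists_glue [FiniteDimensional k Q] {S : CommAlgCat.{u} k}
    {R : Sieve (Opposite.op S)} (hR : R ∈ fppfTopology k (Opposite.op S))
    (x : ∀ (T : CommAlgCat.{u} k) (f : S ⟶ T), R f.op → Module.End T (T ⊗[k] Q))
    (hx : ∀ (T W : CommAlgCat.{u} k) (f : S ⟶ T) (hf : R f.op) (g : T ⟶ W),
      endMap Q g (x T f hf) = x W (f ≫ g) (R.downward_closed hf g.op)) :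
    ∃ y : Module.End S (S ⊗[k] Q), ∀ (T : CommAlgCat.{u} k) (f : S ⟶ T) (hf : R f.op),
      endMap Q f y = x T f hf := by
  have key (q : Q) : ∃ y : S ⊗[k] Q, ∀ (T : CommAlgCat.{u} k) (f : S ⟶ T) (hf : R f.op),
      changeMap Q f y = x T f hf ((1 : T) ⊗ₜ[k] q) :=
    (isFppfSheaf_tensorFunctor Q).exists_glue hR (fun T f hf => x T f hf ((1 : T) ⊗ₜ[k] q))
      fun T W f hf g => by
        change changeMap Q g _ = _
        rw [← endMap_one_tmul, hx]
  choose y hy using key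
  let l : Q →ₗ[k] S ⊗[k] Q :=
    { toFun := y
      map_add' := fun p q => changeMap_eq_of_locally_eq hR fun T f hf => by
        simp only [map_add, hy _ T f hf, TensorProduct.tmul_add]
      map_smul' := fun c q => changeMap_eq_of_locally_eq hR fun T f hf => by
        simp only [map_smul, hy _ T f hf, TensorProduct.tmul_smul, RingHom.id_apply]
        exact ((x T f hf).restrictScalars k).map_smul c _ }
  exact ⟨l.liftBaseChange S, fun T f hf => endMap_liftBaseChange f fun q => (hy q T f hf).symm⟩

variable (Q) in

theorem isFppfSheaf_GLf [FiniteDimensional k Q] : IsFppfSheaf (GLf k Q).points where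
  eq_of_locally_eq hR h := GLf.ext (end_eq_of_locally_eq hR fun T f hf =>
    congrArg GLf.toEnd (h T f hf))
  exists_glue {S R} hR x hx := by
    change ∀ (T : CommAlgCat.{u} k) (f : S ⟶ T), R f.op → (GLf k Q).obj T at x
    have hx' : ∀ (T W : CommAlgCat.{u} k) (f : S ⟶ T) (hf : R f.op) (g : T ⟶ W),
      (GLf k Q).map g (x T f hf) = x W (f ≫ g) (R.downward_closed hf g.op) := hx
    obtain ⟨y, hy⟩ := end_exists_glue hR (fun T f hf => GLf.toEnd (x T f hf))
      fun T W f hf g => by rw [← GLf.toEnd_map, hx']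
    obtain ⟨z, hz⟩ := end_exists_glue hR (fun T f hf => GLf.toEnd (x T f hf)⁻¹)
      fun T W f hf g => by rw [← GLf.toEnd_map, map_inv, hx']
    have hyz : y * z = 1 := end_eq_of_locally_eq hR fun T f hf => by
      change endMapHom Q f (y * z) = endMapHom Q f 1
      rw [map_mul, map_one]
      change endMap Q f y * endMap Q f z = 1
      rw [hy T f hf, hz T f hf, ← GLf.toEnd_mul, mul_inv_cancel, GLf.toEnd_one]
    have hzy : z * y = 1 := end_eq_of_locally_eq hR fun T f hf => by
      change endMapHom Q f (z * y) = endMapHom Q f 1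
      rw [map_mul, map_one]
      change endMap Q f z * endMap Q f y = 1
      rw [hy T f hf, hz T f hf, ← GLf.toEnd_mul, inv_mul_cancel, GLf.toEnd_one]
    exact ⟨(⟨y, z, hyz, hzy⟩ : LinearMap.GeneralLinearGroup S (S ⊗[k] Q)),
      fun T f hf => GLf.ext (hy T f hf)⟩
end GeneralLinear

/-! ### Descent for the extension group -/

section Schreier

variable {G : KGroup k} {N : NormalSubgroupFunctor G} {Q : Type u} [AddCommGroup Q] [Module k Q]
  [FiniteDimensional k Q] {ρ : N.toKGroup ⟶ GLf k Q} {V : Submodule k Q}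
  {ρV : G ⟶ GLf k V} {α : G.points ⟶ (GLf k Q).points}

/-- Membership in `U` is local, because it amounts to identities between points of `GL_k(Q)` and of
`S ⊗ Q`. -/
theorem mem_unipotentU_of_locally {S : CommAlgCat.{u} k} {R : Sieve (Opposite.op S)}
    (hR : R ∈ fppfTopology k (Opposite.op S)) {x : (GLf k Q).obj S}
    (h : ∀ (T : CommAlgCat.{u} k) (f : S ⟶ T), R f.op → (GLf k Q).map f x ∈ unipotentU ρ V T) :
    x ∈ unipotentU ρ V S := by
  simp only [mem_unipotentU_iff] at h ⊢
  refine ⟨fun T f n => ?_, fun w => ?_⟩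
  · refine (isFppfSheaf_GLf Q).eq_of_locally_eq ((fppfTopology k).pullback_stable f.op hR)
      fun W g hg => ?_
    have h1 := (h W (f ≫ g) hg).1 W (𝟙 W) (N.toKGroup.map g n)
    rw [CategoryTheory.Functor.map_id, Functor.map_comp, ← pt_map] at h1
    change (GLf k Q).map g (_ * _) = (GLf k Q).map g (_ * _)
    rw [map_mul, map_mul]
    exact h1
  · refine changeMap_eq_of_locally_eq hR fun T f hf => ?_
    have h2 (v : S ⊗[k] V) : changeMap Q f (inclMap V S v) = inclMap V T (changeMap V f v) := by
      induction v with
      | zero => simp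
      | add a b ha hb => simp only [map_add, ha, hb]
      | tmul s v => rfl
    rw [← endMap_changeMap, ← GLf.toEnd_map, h2, (h T f hf).2]

theorem isFppfSheaf_diamond (hα : IsStructureMap ρ V ρV α) (hG : IsFppfSheaf G.points) :
    IsFppfSheaf (diamond hα).points where
  eq_of_locally_eq hR h := DiamondPoints.ext_act
    ((isFppfSheaf_GLf Q).eq_of_locally_eq hR fun T f hf =>
      (DiamondPoints.act_map f _).symm.trans
        ((congrArg DiamondPoints.act (h T f hf)).trans (DiamondPoints.act_map f _)))
    (hG.eq_of_locally_eq hR fun T f hf => congrArg DiamondPoints.snd (h T f hf))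
  exists_glue {S R} hR x hx := by
    change ∀ (T : CommAlgCat.{u} k) (f : S ⟶ T), R f.op → DiamondPoints hα T at x
    replace hx : ∀ (T W : CommAlgCat.{u} k) (f : S ⟶ T) (hf : R f.op) (g : T ⟶ W),
      (x T f hf).map g = x W (f ≫ g) (R.downward_closed hf g.op) := hx
    obtain ⟨g, hg⟩ := hG.exists_glue hR (fun T f hf => (x T f hf).snd)
      fun T W f hf g => congrArg DiamondPoints.snd (hx T W f hf g)
    obtain ⟨y, hy⟩ := (isFppfSheaf_GLf Q).exists_glue hR
      (fun T f hf => ((x T f hf).fst : (GLf k Q).obj T)) fun T W f hf g =>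
        congrArg (fun z : DiamondPoints hα W => (z.fst : (GLf k Q).obj W)) (hx T W f hf g)
    change (GLf k Q).obj S at y
    have hmem : y ∈ unipotentU ρ V S := mem_unipotentU_of_locally hR fun T f hf => by
      rw [show (GLf k Q).map f y = _ from hy T f hf]
      exact (x T f hf).fst.2
    exact ⟨(⟨⟨y, hmem⟩, g⟩ : DiamondPoints hα S),
      fun T f hf => DiamondPoints.ext (Subtype.ext (hy T f hf)) (hg T f hf)⟩

end Schreier

/-! ### Points of quotients -/

namespace NormalSubgroupFunctor

variable {G H : KGroup k} (N : NormalSubgroupFunctor G)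

/-- The presheaf of groups `S ↦ G(S) / N(S)`, moved one universe up, whose associated sheaf is
`G / N`. -/
abbrev quotientPresheaf : (CommAlgCat.{u} k)ᵒᵖᵒᵖ ⥤ GrpCat.{u + 1} :=
  unopUnop (CommAlgCat.{u} k) ⋙ N.naiveQuotient ⋙ GrpCat.uliftFunctor.{u + 1, u}

/-- The `S`-points of `G / N`. -/
noncomputable abbrev quotientPoints (S : CommAlgCat.{u} k) : GrpCat.{u + 1} :=
  N.quotient.obj.obj (Opposite.op (Opposite.op S))

/-- The class in `(G / N)(S)` of an `S`-point of `G`. -/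
noncomputable def quotientMk (S : CommAlgCat.{u} k) : G.obj S →* N.quotientPoints S :=
  ((toSheafify (fppfTopology k) N.quotientPresheaf).app (Opposite.op (Opposite.op S))).hom.comp
    (MulEquiv.ulift.symm.toMonoidHom.comp (QuotientGroup.mk' (N.carrier S)))

theorem map_quotientMk {S T : CommAlgCat.{u} k} (f : S ⟶ T) (g : G.obj S) :
    N.quotient.obj.map f.op.op (N.quotientMk S g) = N.quotientMk T (G.map f g) :=
  (NatTrans.naturality_apply (toSheafify (fppfTopology k) N.quotientPresheaf) f.op.op _).symm

theorem quotientMk_eq_one {S : CommAlgCat.{u} k} {g : G.obj S} (hg : g ∈ N.carrier S) :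
    N.quotientMk S g = 1 := by
  have h1 : QuotientGroup.mk' (N.carrier S) g = QuotientGroup.mk' (N.carrier S) 1 :=
    (QuotientGroup.eq_one_iff g).mpr hg
  refine Eq.trans ?_ (map_one (N.quotientMk S))
  exact congrArg (fun q => (toSheafify (fppfTopology k) N.quotientPresheaf).app
    (Opposite.op (Opposite.op S)) (ULift.up q)) h1

/-- Points with the same class in `G / N` differ locally by a point of `N`. -/
theorem exists_cover_of_quotientMk_eq {S : CommAlgCat.{u} k} {g h : G.obj S}
    (hgh : N.quotientMk S g = N.quotientMk S h) : ∃ R ∈ fppfTopology k (Opposite.op S),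
      ∀ (T : CommAlgCat.{u} k) (f : S ⟶ T), R f.op →
        ∃ n ∈ N.carrier T, G.map f h = G.map f g * n := by
  refine ⟨_, Presheaf.equalizerSieve_mem (fppfTopology k)
    (toSheafify (fppfTopology k) N.quotientPresheaf) _ _ hgh, fun T f hf => ?_⟩
  have h1 : QuotientGroup.mk' (N.carrier T) (G.map f g) =
      QuotientGroup.mk' (N.carrier T) (G.map f h) := congrArg ULift.down hf
  obtain ⟨n, hn, h2⟩ := (QuotientGroup.mk'_eq_mk' _).mp h1
  exact ⟨n, hn, h2.symm⟩

/-- Every point of `G / N` is locally the class of a point of `G`. -/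
theorem exists_cover_quotientMk_eq {S : CommAlgCat.{u} k} (x : N.quotientPoints S) :
    ∃ R ∈ fppfTopology k (Opposite.op S), ∀ (T : CommAlgCat.{u} k) (f : S ⟶ T), R f.op →
      ∃ g : G.obj T, N.quotientMk T g = N.quotient.obj.map f.op.op x := by
  refine ⟨_, Presheaf.imageSieve_mem (fppfTopology k)
    (toSheafify (fppfTopology k) N.quotientPresheaf) x, fun T f hf => ?_⟩
  obtain ⟨⟨y⟩, hy⟩ := hf
  obtain ⟨g, rfl⟩ := QuotientGroup.mk'_surjective (N.carrier T) y
  exact ⟨g, hy⟩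

theorem quotient_eq_of_locally_eq {S : CommAlgCat.{u} k} {R : Sieve (Opposite.op S)}
    {x y : N.quotientPoints S} (hR : R ∈ fppfTopology k (Opposite.op S))
    (h : ∀ (T : CommAlgCat.{u} k) (f : S ⟶ T), R f.op →
      N.quotient.obj.map f.op.op x = N.quotient.obj.map f.op.op y) : x = y :=
  N.quotient.isSeparated _ _ hR _ _ fun T f hf => h T.unop f.unop hf

theorem quotientMap_quotientMk (M : NormalSubgroupFunctor H) (φ : G ⟶ H)
    (h : ∀ (S : CommAlgCat.{u} k) (n : G.obj S), n ∈ N.carrier S → pt φ n ∈ M.carrier S)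
    {S : CommAlgCat.{u} k} (g : G.obj S) :
    (N.quotientMap M φ h).hom.app (Opposite.op (Opposite.op S)) (N.quotientMk S g) =
      M.quotientMk S (pt φ g) := by
  have := toSheafify_naturality (fppfTopology k)
    (Functor.whiskerLeft (unopUnop (CommAlgCat.{u} k))
      (Functor.whiskerRight (naiveQuotientMap N M φ h) GrpCat.uliftFunctor.{u + 1, u}))
  exact (ConcreteCategory.congr_hom (NatTrans.congr_app this (Opposite.op (Opposite.op S))) _).symm

variable {N}

theorem quotientMap_comp_eq_id {M : NormalSubgroupFunctor H} (φ : G ⟶ H) (ψ : H ⟶ G)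
    (hφ : ∀ (S : CommAlgCat.{u} k) (n : G.obj S), n ∈ N.carrier S → pt φ n ∈ M.carrier S)
    (hψ : ∀ (S : CommAlgCat.{u} k) (n : H.obj S), n ∈ M.carrier S → pt ψ n ∈ N.carrier S)
    (h : φ ≫ ψ = 𝟙 G) : N.quotientMap M φ hφ ≫ M.quotientMap N ψ hψ = 𝟙 N.quotient := by
  have h1 : naiveQuotientMap N M φ hφ ≫ naiveQuotientMap M N ψ hψ = 𝟙 _ := by
    ext S x
    obtain ⟨g, rfl⟩ := QuotientGroup.mk_surjective x
    exact congrArg (QuotientGroup.mk (s := N.carrier S))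
      (ConcreteCategory.congr_hom (NatTrans.congr_app h S) g)
  refine ((presheafToSheaf (fppfTopology k) GrpCat.{u + 1}).map_comp _ _).symm.trans ?_
  rw [← Functor.whiskerLeft_comp, ← Functor.whiskerRight_comp, h1]
  exact (presheafToSheaf (fppfTopology k) GrpCat.{u + 1}).map_id N.quotientPresheaf

end NormalSubgroupFunctor

/-! ### Lifting a section of quotients -/

section Lift

variable {G H : KGroup k} {N : NormalSubgroupFunctor G} {M : NormalSubgroupFunctor H}

/-- The point `x` of `H` lies over the point `g` of `G`, and its class in `H / M` is the image under
`σ` of the class of `g` in `G / N`. -/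
def IsLift (π : H ⟶ G) (σ : N.quotient ⟶ M.quotient) {S : CommAlgCat.{u} k} (g : G.obj S)
    (x : H.obj S) : Prop :=
  pt π x = g ∧ M.quotientMk S x = σ.hom.app (Opposite.op (Opposite.op S)) (N.quotientMk S g)

namespace IsLift

variable {π : H ⟶ G} {σ : N.quotient ⟶ M.quotient} {S T : CommAlgCat.{u} k}

theorem mul {g h : G.obj S} {x y : H.obj S} (hx : IsLift π σ g x) (hy : IsLift π σ h y) :
    IsLift π σ (g * h) (x * y) :=
  ⟨by rw [pt_mul, hx.1, hy.1], by rw [map_mul, map_mul, map_mul, hx.2, hy.2]⟩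

theorem map (f : S ⟶ T) {g : G.obj S} {x : H.obj S} (hx : IsLift π σ g x) :
    IsLift π σ (G.map f g) (H.map f x) :=
  ⟨by rw [← pt_map, hx.1], by
    rw [← M.map_quotientMk, ← N.map_quotientMk, hx.2, NatTrans.naturality_apply]⟩

theorem of_mem (hπ : ∀ (S : CommAlgCat.{u} k) (m : H.obj S), m ∈ M.carrier S →
      pt π m ∈ N.carrier S) {m : H.obj S} (hm : m ∈ M.carrier S) : IsLift π σ (pt π m) m :=
  ⟨rfl, by rw [M.quotientMk_eq_one hm, N.quotientMk_eq_one (hπ S m hm), map_one]⟩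

/-- Lifts are unique: two lifts of `g` differ locally by a point of `M` over `1`, and such a point
is trivial. -/
theorem eq (hH : IsFppfSheaf H.points)
    (inj : ∀ (S : CommAlgCat.{u} k) (m : H.obj S), m ∈ M.carrier S → pt π m = 1 → m = 1)
    {g : G.obj S} {x y : H.obj S} (hx : IsLift π σ g x) (hy : IsLift π σ g y) : x = y := by
  obtain ⟨R, hR, h⟩ := M.exists_cover_of_quotientMk_eq (hx.2.trans hy.2.symm)
  refine hH.eq_of_locally_eq hR fun T f hf => ?_
  obtain ⟨m, hm, e⟩ := h T f hf
  have h1 : pt π m = 1 := by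
    have h2 := congrArg (pt π) e
    rwa [pt_mul, ← pt_map, ← pt_map, hx.1, hy.1, left_eq_mul] at h2
  change H.map f x = H.map f y
  rw [e, inj T m hm h1, mul_one]

theorem exists_locally
    (hπ : ∀ (S : CommAlgCat.{u} k) (m : H.obj S), m ∈ M.carrier S → pt π m ∈ N.carrier S)
    (surj : ∀ (S : CommAlgCat.{u} k) (n : G.obj S), n ∈ N.carrier S →
      ∃ m ∈ M.carrier S, pt π m = n)
    (hσ : σ ≫ M.quotientMap N π hπ = 𝟙 N.quotient) (g : G.obj S) :
    ∃ R ∈ fppfTopology k (Opposite.op S), ∀ (T : CommAlgCat.{u} k) (f : S ⟶ T), R f.op →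
      ∃ x : H.obj T, IsLift π σ (G.map f g) x := by
  obtain ⟨R, hR, h⟩ := M.exists_cover_quotientMk_eq
    (σ.hom.app (Opposite.op (Opposite.op S)) (N.quotientMk S g))
  choose x hx using h
  replace hx : ∀ (T : CommAlgCat.{u} k) (f : S ⟶ T) (hf : R f.op), M.quotientMk T (x T f hf) =
      σ.hom.app (Opposite.op (Opposite.op T)) (N.quotientMk T (G.map f g)) := fun T f hf => by
    rw [hx, ← N.map_quotientMk, NatTrans.naturality_apply]
  -- The image of `x` in `G` has the right class modulo `N`, hence is locally correct up to `N`.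
  have hπx (T : CommAlgCat.{u} k) (f : S ⟶ T) (hf : R f.op) :
      N.quotientMk T (pt π (x T f hf)) = N.quotientMk T (G.map f g) := by
    rw [← M.quotientMap_quotientMk N π hπ, hx]
    exact ConcreteCategory.congr_hom (NatTrans.congr_app (congrArg (fun τ => τ.hom) hσ)
      (Opposite.op (Opposite.op T))) (N.quotientMk T (G.map f g))
  let R' : Sieve (Opposite.op S) :=
    { arrows := fun T f => ∃ y : H.obj T.unop, IsLift π σ (G.map f.unop g) y
      downward_closed := by
        rintro T W f ⟨y, hy⟩ c
        refine ⟨H.map c.unop y, ?_⟩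
        have h1 := hy.map c.unop
        rwa [← ConcreteCategory.comp_apply, ← Functor.map_comp] at h1 }
  refine ⟨R', (fppfTopology k).transitive hR R' fun {T} f hf => ?_, fun T f hf => hf⟩
  obtain ⟨R'', hR'', h''⟩ := N.exists_cover_of_quotientMk_eq (hπx T.unop f.unop hf)
  refine (fppfTopology k).superset_covering ?_ hR''
  intro W c hc
  obtain ⟨n, hn, e⟩ := h'' W.unop c.unop hc
  obtain ⟨m, hm, rfl⟩ := surj _ n hn
  have h1 : G.map (c ≫ f).unop g = G.map c.unop (G.map f.unop g) := by
    rw [← ConcreteCategory.comp_apply, ← Functor.map_comp]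
    rfl
  refine ⟨H.map c.unop (x T.unop f.unop hf) * m, ?_, ?_⟩
  · rw [pt_mul, ← pt_map, ← e, h1]
  · rw [map_mul, M.quotientMk_eq_one hm, mul_one, ← M.map_quotientMk, hx, h1,
      ← N.map_quotientMk c.unop, NatTrans.naturality_apply]

theorem exists_isLift (hG : IsFppfSheaf G.points) (hH : IsFppfSheaf H.points)
    (hπ : ∀ (S : CommAlgCat.{u} k) (m : H.obj S), m ∈ M.carrier S → pt π m ∈ N.carrier S)
    (inj : ∀ (S : CommAlgCat.{u} k) (m : H.obj S), m ∈ M.carrier S → pt π m = 1 → m = 1)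
    (surj : ∀ (S : CommAlgCat.{u} k) (n : G.obj S), n ∈ N.carrier S →
      ∃ m ∈ M.carrier S, pt π m = n)
    (hσ : σ ≫ M.quotientMap N π hπ = 𝟙 N.quotient) (g : G.obj S) :
    ∃ x : H.obj S, IsLift π σ g x := by
  obtain ⟨R, hR, h⟩ := exists_locally hπ surj hσ g
  choose x hx using h
  obtain ⟨y, hy⟩ := hH.exists_glue hR x fun T W f hf c => by
    have h1 := (hx T f hf).map c
    rw [← ConcreteCategory.comp_apply, ← Functor.map_comp] at h1
    exact h1.eq hH inj (hx W (f ≫ c) _)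
  change H.obj S at y
  replace hy : ∀ (T : CommAlgCat.{u} k) (f : S ⟶ T) (hf : R f.op), H.map f y = x T f hf := hy
  refine ⟨y, hG.eq_of_locally_eq hR fun T f hf => ?_,
    M.quotient_eq_of_locally_eq hR fun T f hf => ?_⟩
  · change G.map f (pt π y) = G.map f g
    rw [pt_map, hy T f hf, (hx T f hf).1]
  · rw [M.map_quotientMk, hy T f hf, (hx T f hf).2, ← N.map_quotientMk, NatTrans.naturality_apply]

end IsLift

/-- A homomorphism `π : H → G` mapping `M` isomorphically onto `N` makes `H` the fibre product of
`G` and `H / M` over `G / N`, so a section of `H / M → G / N` pulls back to a section of `π`, which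
is then inverse to `π` on `M`. -/
theorem exists_section_of_quotient_section (hG : IsFppfSheaf G.points) (hH : IsFppfSheaf H.points)
    (π : H ⟶ G)
    (hπ : ∀ (S : CommAlgCat.{u} k) (m : H.obj S), m ∈ M.carrier S → pt π m ∈ N.carrier S)
    (inj : ∀ (S : CommAlgCat.{u} k) (m : H.obj S), m ∈ M.carrier S → pt π m = 1 → m = 1)
    (surj : ∀ (S : CommAlgCat.{u} k) (n : G.obj S), n ∈ N.carrier S →
      ∃ m ∈ M.carrier S, pt π m = n)
    (σ : N.quotient ⟶ M.quotient) (hσ : σ ≫ M.quotientMap N π hπ = 𝟙 N.quotient) :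
    ∃ s : G ⟶ H, s ≫ π = 𝟙 G ∧
      ∀ (S : CommAlgCat.{u} k) (m : H.obj S), m ∈ M.carrier S → pt s (pt π m) = m := by
  choose s hs using fun (S : CommAlgCat.{u} k) (g : G.obj S) =>
    IsLift.exists_isLift hG hH hπ inj surj hσ g
  refine ⟨{ app := fun S => GrpCat.ofHom (MonoidHom.mk' (s S) fun g h =>
              (hs S (g * h)).eq hH inj ((hs S g).mul (hs S h)))
            naturality := fun S T f => ?_ }, ?_, fun S m hm => ?_⟩
  · ext g
    exact (hs T (G.map f g)).eq hH inj ((hs S g).map f)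
  · ext S g
    exact (hs S g).1
  · exact (hs S _).eq hH inj (.of_mem hπ hm)

end Lift

/-! ### The representation of the extension group and its sections -/

section Representation

variable {G : KGroup k} {N : NormalSubgroupFunctor G} {Q : Type u} [AddCommGroup Q] [Module k Q]
  [FiniteDimensional k Q] {ρ : N.toKGroup ⟶ GLf k Q} {V : Submodule k Q}
  {ρV : G ⟶ GLf k V} {α : G.points ⟶ (GLf k Q).points}

/-- The representation `(u, g) ↦ u α(g)` of `G^⋄` on `Q`. -/
noncomputable def diamondAct (hα : IsStructureMap ρ V ρV α) : diamond hα ⟶ GLf k Q where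
  app S := GrpCat.ofHom (MonoidHom.mk' DiamondPoints.act DiamondPoints.act_mul)
  naturality S T f := by
    ext x : 2
    exact DiamondPoints.act_map f x

theorem toEnd_act_inclMap {hα : IsStructureMap ρ V ρV α} {S : CommAlgCat.{u} k}
    (x : DiamondPoints hα S) (v : S ⊗[k] V) :
    GLf.toEnd x.act (inclMap V S v) = inclMap V S (GLf.toEnd (pt ρV x.snd) v) := by
  rw [DiamondPoints.act, GLf.toEnd_mul, Module.End.mul_apply, hα.restrict,
    ((mem_unipotentU_iff _).mp x.fst.2).2]

/-- `ρ_G(g)` and `α(g)` conjugate `N` in the same way and agree on `V`, so their quotient lies in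
`U`. -/
theorem mul_inv_mem_unipotentU (hα : IsStructureMap ρ V ρV α) {ρG : G ⟶ GLf k Q}
    (hN : N.incl ≫ ρG = ρ)
    (hV : ∀ (S : CommAlgCat.{u} k) (g : G.obj S) (v : S ⊗[k] V),
      GLf.toEnd (pt ρG g) (inclMap V S v) = inclMap V S (GLf.toEnd (pt ρV g) v))
    {S : CommAlgCat.{u} k} (g : G.obj S) : pt ρG g * (val α g)⁻¹ ∈ unipotentU ρ V S := by
  rw [mem_unipotentU_iff]
  refine ⟨fun T f n => ?_, fun w => ?_⟩
  · rw [map_mul, map_inv, pt_map, val_map]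
    generalize G.map f g = g'
    have h1 (m : N.toKGroup.obj T) : pt ρ (N.conj g' m) = pt ρG g' * pt ρ m * (pt ρG g')⁻¹ := by
      have h2 (m : N.toKGroup.obj T) : pt ρ m = pt ρG (pt N.incl m) := by rw [← hN]; rfl
      rw [h2, h2, ← pt_inv, ← pt_mul, ← pt_mul]
      rfl
    rw [← IsStructureMap.conj_conj_inv g' n]
    generalize N.conj g'⁻¹ n = m
    change _ * _ = _ * _
    conv_lhs => rw [hα.pt_conj]
    conv_rhs => rw [h1]
    group
  · rw [GLf.toEnd_mul, Module.End.mul_apply, hα.toEnd_inv_inclMap, hV, ← Module.End.mul_apply,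
      ← GLf.toEnd_mul, mul_inv_cancel]
    rfl

theorem exists_section_of_extension (hα : IsStructureMap ρ V ρV α) {ρG : G ⟶ GLf k Q}
    (hN : N.incl ≫ ρG = ρ)
    (hV : ∀ (S : CommAlgCat.{u} k) (g : G.obj S) (v : S ⊗[k] V),
      GLf.toEnd (pt ρG g) (inclMap V S v) = inclMap V S (GLf.toEnd (pt ρV g) v)) :
    ∃ σ : G ⟶ diamond hα, σ ≫ diamondProj hα = 𝟙 G ∧ N.incl ≫ σ = diamondIota hα := by
  let s {S : CommAlgCat.{u} k} (g : G.obj S) : DiamondPoints hα S :=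
    ⟨⟨pt ρG g * (val α g)⁻¹, mul_inv_mem_unipotentU hα hN hV g⟩, g⟩
  have hs {S : CommAlgCat.{u} k} (g : G.obj S) : (s g).act = pt ρG g :=
    inv_mul_cancel_right _ _
  refine ⟨{ app := fun S => GrpCat.ofHom (MonoidHom.mk' (fun g => s g) fun g h =>
              DiamondPoints.ext_act ?_ rfl)
            naturality := fun S T f => ?_ }, ?_, ?_⟩
  · rw [DiamondPoints.act_mul, hs, hs, hs, pt_mul]
  · ext g : 2
    refine DiamondPoints.ext_act ?_ rfl
    refine (hs _).trans (Eq.trans ?_ (DiamondPoints.act_map f (s g)).symm)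
    rw [hs, pt_map]
    rfl
  · ext S g
    rfl
  · ext S n : 4
    refine DiamondPoints.ext_act ?_ rfl
    refine (hs _).trans (Eq.trans ?_ (hα.act_iota n).symm)
    rw [← hN]
    rfl

end Representation

end KGroups

theorem corollary3p7 {k : Type u} [Field k] [IsAlgClosed k]
    (G : KGroup k) (hG : IsConnectedAffineAlgebraicGroup G)
    (N : NormalSubgroupFunctor G) (hN : N.IsClosed)
    (Q : Type u) [AddCommGroup Q] [Module k Q] [FiniteDimensional k Q]
    (ρ : N.toKGroup ⟶ GLf k Q)
    (V : Submodule k Q) (ρV : G ⟶ GLf k V) (hV : IsGSubmodule ρ V ρV)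
    (hsoc : socle ρ ≤ V)
    (α : G.points ⟶ (GLf k Q).points) (hα : IsStructureMap ρ V ρV α) :
    List.TFAE [
      -- the `N`-action on `Q` extends to a rational `G`-action agreeing with that on `V`
      ∃ ρG : G ⟶ GLf k Q, N.incl ≫ ρG = ρ ∧
        ∀ (S : CommAlgCat.{u} k) (g : G.obj S) (v : S ⊗[k] V),
          GLf.toEnd (pt ρG g) (inclMap V S v) = inclMap V S (GLf.toEnd (pt ρV g) v),
      -- the extension `G^⋄` of `G` by `U` is split by a homomorphism extending `ι`
      ∃ σ : G ⟶ diamond hα, σ ≫ diamondProj hα = 𝟙 G ∧ N.incl ≫ σ = diamondIota hα,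
      -- the extension `G^⋄ / ι(N)` of `G / N` by `U` is split
      ∃ σ : N.quotient ⟶ (diamondN hα).quotient, σ ≫ diamondQuotientProj hα = 𝟙 N.quotient] := by
  tfae_have 1 → 2 := fun ⟨ρG, h1, h2⟩ => exists_section_of_extension hα h1 h2
  tfae_have 2 → 1 := by
    rintro ⟨σ, h1, h2⟩
    refine ⟨σ ≫ diamondAct hα, ?_, fun S g v => ?_⟩
    · rw [← Category.assoc, h2]
      refine NatTrans.ext (funext fun S => GrpCat.hom_ext (MonoidHom.ext fun n => ?_))
      exact hα.act_iota n
    · have h3 : DiamondPoints.snd (pt σ g) = g :=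
        ConcreteCategory.congr_hom (NatTrans.congr_app h1 S) g
      refine (toEnd_act_inclMap (hα := hα) (pt σ g) v).trans ?_
      rw [h3]
  tfae_have 2 → 3 := by
    rintro ⟨σ, h1, h2⟩
    refine ⟨N.quotientMap (diamondN hα) σ fun S n hn => ⟨(⟨n, hn⟩ : N.carrier S), ?_⟩,
      NormalSubgroupFunctor.quotientMap_comp_eq_id _ _ _ _ h1⟩
    rw [← h2]
    rfl
  tfae_have 3 → 2 := by
    rintro ⟨σ, hσ⟩
    obtain ⟨A, ⟨r⟩, -⟩ := hG
    have hGs := isFppfSheaf_of_corepresentableBy r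
    have inj (S : CommAlgCat.{u} k) (m : (diamond hα).obj S) (hm : m ∈ (diamondN hα).carrier S)
        (h : pt (diamondProj hα) m = 1) : m = 1 := by
      obtain ⟨n, rfl⟩ := hm
      have h3 : n = 1 := Subtype.ext h
      rw [h3, map_one]
    have surj (S : CommAlgCat.{u} k) (n : G.obj S) (hn : n ∈ N.carrier S) :
        ∃ m ∈ (diamondN hα).carrier S, pt (diamondProj hα) m = n :=
      ⟨_, ⟨(⟨n, hn⟩ : N.carrier S), rfl⟩, rfl⟩
    obtain ⟨s, h1, h2⟩ := exists_section_of_quotient_section hGs (isFppfSheaf_diamond hα hGs)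
      (diamondProj hα) _ inj surj σ hσ
    refine ⟨s, h1, NatTrans.ext (funext fun S => GrpCat.hom_ext (MonoidHom.ext fun n => ?_))⟩
    exact h2 S _ ⟨n, rfl⟩
  tfae_finish
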